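/- Let $\mathbb X$ be a separable reflexive real Banach space, $\mathbb U$ a reflexive real Banach space, $K_{ad}$ a subset of a topological space $\mathbb K$, $1<p<\infty$, $R>0$, $x_0\in\mathbb X$. Assume: - $\mathcal A$, with domain $D(\mathcal A)$, generates a strongly continuous semigroup $\mathcal T(t)$ on $\mathbb X$. - $\mathcal F:\mathbb X\to\mathbb X$ satisfies $\mathcal F(0)=0$, and for every $\delta>0$ there is $L_\delta>0$ with $\|\mathcal F(x_2)-\mathcal F(x_1)\|\le L_\delta\|x_2-x_1\|$ whenever $\|x_1\|,\|x_2\|\le\delta$. - $\mathcal B(r)\in\mathcal L(\mathbb U,\mathbb X)$ for every $r\in K_{ad}$, and $\sup_{r\in K_{ad}}\|\mathcal B(r)\|<\infty$. - $\mathcal F$ is Gâteaux differentiable on $\mathbb X$: for every $x$ there is $\mathcal F'_x\in\mathcal L(\mathbb X)$ such that $\mathcal F'_x h$ is the derivative of $\mathcal F$ at $x$ in the direction $h$, for all $h\in\mathbb X$. Moreover $x\mapsto\mathcal F'_x$ maps bounded sets of $\mathbb X$ to bounded sets of $\mathcal L(\mathbb X)$. For $\tau>0$ put $U_{ad}=\{u\in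 L^p(0,\tau;\mathbb U):\|u\|_p\le R\}$. A mild solution of $\dot x=\mathcal Ax+\mathcal F(x)+\mathcal B(r)u$, $x(0)=x_0$, on $[0,\tau]$ is an $x\in C([0,\tau];\mathbb X)$ with $$x(t)=\mathcal T(t)x_0+\int_0^t\mathcal T(t-s)\mathcal F(x(s))\,ds+\int_0^t\mathcal T(t-s)\mathcal B(r)u(s)\,ds,\qquad t\in[0,\tau].$$ Call $\tau$ admissible if this equation has a mild solution on $[0,\tau]$ for all $u\in U_{ad}$ and all $r\in K_{ad}$. Then an admissible $\tau>0$ exists. Moreover, for every admissible $\tau>0$ and every $r\in K_{ad}$: 1. For every $u\in U_{ad}$ the mild solution on $[0,\tau]$ is unique, so that the control-to-state map $\mathcal S(\cdot\,;r,x_0):U_{ad}\to L^p(0,\tau;\mathbb X)$, which sends $u$ to the mild solution, is well defined. 2. $\mathcal S(\cdot\,;r,x_0)$ is Gâteaux differentiable at every interior point $u^o$ of $U_{ad}$: there is a bounded linear operator $\mathcal S'_{u^o}:L^p(0,\tau;\mathbb U)\to L^p(0,\tau;\mathbb X)$ such that $\mathcal S'_{u^o}\tilde u$ is the derivative of $\mathcal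 S(\cdot\,;r,x_0)$ at $u^o$ in the direction $\tilde u$, for every $\tilde u\in L^p(0,\tau;\mathbb U)$. With $x^o=\mathcal S(u^o;r,x_0)$ (the continuous mild solution), $\mathcal S'_{u^o}\tilde u=\tilde x$, where $\tilde x\in C([0,\tau];\mathbb X)$ is the unique mild solution of $$\dot{\tilde x}(t)=(\mathcal A+\mathcal F'_{x^o(t)})\tilde x(t)+\mathcal B(r)\tilde u(t),\qquad \tilde x(0)=0,$$ that is, $\tilde x(t)=\int_0^t\mathcal T(t-s)\mathcal F'_{x^o(s)}\tilde x(s)\,ds+\int_0^t\mathcal T(t-s)\mathcal B(r)\tilde u(s)\,ds$ for $t\in[0,\tau]$. 3. For every such $u^o$ there are operators $\mathcal U(t,s)\in\mathcal L(\mathbb X)$, $0\le s\le t\le\tau$, not depending on $\tilde u$, which form the strongly continuous evolution operator of $\mathcal A+\mathcal F'_{x^o(t)}$, that is: $\mathcal U(s,s)=I$; $\mathcal U(t,\sigma)\,\mathcal U(\sigma,s)=\mathcal U(t,s)$ for $s\le\sigma\le t$; $(t,s)\mapsto\mathcal U(t,s)x$ is continuous for each $x\in\mathbb X$; and $\mathcal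 U(t,s)x=\mathcal T(t-s)x+\int_s^t\mathcal T(t-\sigma)\mathcal F'_{x^o(\sigma)}\,\mathcal U(\sigma,s)x\,d\sigma$. For every $\tilde u\in L^p(0,\tau;\mathbb U)$ the solution $\tilde x$ in part 2 is given by $$\tilde x(t)=\int_0^t\mathcal U(t,s)\mathcal B(r)\tilde u(s)\,ds,\qquad t\in[0,\tau].$$ -/

import Mathlib

open Set Filter Topology MeasureTheory
open scoped ENNReal

noncomputable section

namespace ControlToState

variable {X U : Type*} [NormedAddCommGroup X] [NormedSpace ℝ X]
  [NormedAddCommGroup U] [NormedSpace ℝ U]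

/-- A normed space is reflexive if the canonical map into its double dual is onto. -/
def IsReflexive (X : Type*) [NormedAddCommGroup X] [NormedSpace ℝ X] : Prop :=
  Function.Surjective (NormedSpace.inclusionInDoubleDual ℝ X)

/-- Strongly continuous semigroups of bounded operators; the values of `T` at negative times
play no role. -/
structure IsStronglyContinuousSemigroup (T : ℝ → X →L[ℝ] X) : Prop where
  zero : T 0 = ContinuousLinearMap.id ℝ X
  add : ∀ s t : ℝ, 0 ≤ s → 0 ≤ t → T (s + t) = (T s).comp (T t)
  continuousOn : ∀ x : X, ContinuousOn (fun t => T t x) (Ici 0)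

/-- `A`, with its domain, is the infinitesimal generator of `T`: `x ∈ D(A)` and `A x = y` if and
only if `(T(t) x - x) / t → y` as `t ↓ 0`. -/
def IsGenerator (A : X →ₗ.[ℝ] X) (T : ℝ → X →L[ℝ] X) : Prop :=
  ∀ x y : X, (x, y) ∈ A.graph ↔
    Tendsto (fun t : ℝ => t⁻¹ • (T t x - x)) (𝓝[>] 0) (𝓝 y)

/-- `f'` is the Gâteaux derivative of `f` at `x`: it is a bounded linear operator, and `f' h` is
the derivative of `f` at `x` in the direction `h`, for every `h`. -/
def HasGateauxDerivAt {E G : Type*} [NormedAddCommGroup E] [NormedSpace ℝ E]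
    [NormedAddCommGroup G] [NormedSpace ℝ G] (f : E → G) (f' : E →L[ℝ] G) (x : E) : Prop :=
  ∀ h : E, HasLineDerivAt ℝ f (f' h) x h

/-- `x ∈ C([0,τ]; X)` is the mild solution on `[0,τ]` of
`x'(t) = A x(t) + N(t, x(t)) + f(t)`, `x(0) = x₀`, where `A` generates `T`:
`x(t) = T(t) x₀ + ∫₀ᵗ T(t-s) N(s, x(s)) ds + ∫₀ᵗ T(t-s) f(s) ds`,
both integrals being convergent Bochner integrals. -/
structure IsMildSolution (T : ℝ → X →L[ℝ] X) (N : ℝ → X → X) (f : ℝ → X) (x₀ : X) (τ : ℝ)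
    (x : ℝ → X) : Prop where
  continuousOn : ContinuousOn x (Icc 0 τ)
  integrable_perturbation : ∀ t ∈ Icc 0 τ,
    IntervalIntegrable (fun s => T (t - s) (N s (x s))) volume 0 t
  integrable_forcing : ∀ t ∈ Icc 0 τ,
    IntervalIntegrable (fun s => T (t - s) (f s)) volume 0 t
  eq : ∀ t ∈ Icc 0 τ,
    x t = T t x₀ + (∫ s in (0 : ℝ)..t, T (t - s) (N s (x s))) + ∫ s in (0 : ℝ)..t, T (t - s) (f s)

/-- Lebesgue measure on the time interval `(0,τ]`. -/
abbrev timeMeasure (τ : ℝ) : Measure ℝ := volume.restrict (Ioc 0 τ)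

/-- The admissible controls `{u ∈ Lᵖ(0,τ;U) : ‖u‖ₚ ≤ R}`. -/
def admissibleControls (U : Type*) [NormedAddCommGroup U] (p : ℝ≥0∞) (R τ : ℝ) :
    Set (Lp U p (timeMeasure τ)) :=
  {u | ‖u‖ ≤ R}

/-- `x` is a mild solution on `[0,τ]` of the controlled equation
`x'(t) = A x(t) + F(x(t)) + B u(t)`, `x(0) = x₀`. -/
def IsControlledSolution {p : ℝ≥0∞} (T : ℝ → X →L[ℝ] X) (F : X → X) (B : U →L[ℝ] X) (x₀ : X)
    (τ : ℝ) (u : Lp U p (timeMeasure τ)) (x : ℝ → X) : Prop :=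
  IsMildSolution T (fun _ y => F y) (fun s => B (u s)) x₀ τ x

/-- The horizon `τ` is such that the controlled equation has a mild solution on `[0,τ]` for all
admissible controls and all designs. -/
def IsAdmissibleHorizon {K : Type*} (T : ℝ → X →L[ℝ] X) (F : X → X) (B : K → U →L[ℝ] X)
    (p : ℝ≥0∞) (R : ℝ) (x₀ : X) (τ : ℝ) : Prop :=
  ∀ r : K, ∀ u ∈ admissibleControls U p R τ, ∃ x : ℝ → X, IsControlledSolution T F (B r) x₀ τ u x

open Classical in
/-- The state trajectory belonging to the control `u`: the mild solution of the controlled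
equation (the zero path if there is none). -/
def statePath {p : ℝ≥0∞} (T : ℝ → X →L[ℝ] X) (F : X → X) (B : U →L[ℝ] X) (x₀ : X)
    (τ : ℝ) (u : Lp U p (timeMeasure τ)) : ℝ → X :=
  if h : ∃ x : ℝ → X, IsControlledSolution T F B x₀ τ u x then h.choose else fun _ => 0

theorem memLp_of_continuousOn {E : Type*} [NormedAddCommGroup E] {x : ℝ → E} {τ : ℝ}
    (hx : ContinuousOn x (Icc 0 τ))
    (p : ℝ≥0∞) : MemLp x p (timeMeasure τ) := by
  obtain ⟨C, hC⟩ := isCompact_Icc.exists_bound_of_continuousOn hx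
  refine MemLp.of_bound (C := C) ?_ ?_
  · exact (hx.aestronglyMeasurable_of_isCompact isCompact_Icc measurableSet_Icc).mono_set
      Ioc_subset_Icc_self
  · exact (ae_restrict_iff' measurableSet_Ioc).2
      (ae_of_all _ fun t ht => hC t (Ioc_subset_Icc_self ht))

theorem memLp_statePath {p : ℝ≥0∞} (T : ℝ → X →L[ℝ] X) (F : X → X) (B : U →L[ℝ] X) (x₀ : X)
    (τ : ℝ) (u : Lp U p (timeMeasure τ)) :
    MemLp (statePath T F B x₀ τ u) p (timeMeasure τ) := by
  apply memLp_of_continuousOn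
  unfold statePath
  split_ifs with h
  · exact h.choose_spec.continuousOn
  · exact continuousOn_const

/-- The control-to-state map `u ↦ S(u; r, x₀)` from `Lᵖ(0,τ;U)` to `Lᵖ(0,τ;X)`, for `B = B(r)`. -/
def controlToState {p : ℝ≥0∞} (T : ℝ → X →L[ℝ] X) (F : X → X) (B : U →L[ℝ] X) (x₀ : X)
    (τ : ℝ) (u : Lp U p (timeMeasure τ)) : Lp X p (timeMeasure τ) :=
  (memLp_statePath T F B x₀ τ u).toLp (statePath T F B x₀ τ u)

/-- `V(t,s)`, `0 ≤ s ≤ t ≤ τ`, is the strongly continuous evolution operator on `X` belonging to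
the family `A + G(t)`, where `A` generates `T`. -/
structure IsEvolutionOperator (T : ℝ → X →L[ℝ] X) (G : ℝ → X →L[ℝ] X) (τ : ℝ)
    (V : ℝ → ℝ → X →L[ℝ] X) : Prop where
  refl : ∀ s ∈ Icc 0 τ, V s s = ContinuousLinearMap.id ℝ X
  comp : ∀ s σ t : ℝ, 0 ≤ s → s ≤ σ → σ ≤ t → t ≤ τ → V t s = (V t σ).comp (V σ s)
  continuousOn : ∀ x : X,
    ContinuousOn (fun q : ℝ × ℝ => V q.1 q.2 x) {q | 0 ≤ q.2 ∧ q.2 ≤ q.1 ∧ q.1 ≤ τ}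
  integrable : ∀ s t : ℝ, 0 ≤ s → s ≤ t → t ≤ τ → ∀ x : X,
    IntervalIntegrable (fun σ => T (t - σ) (G σ (V σ s x))) volume s t
  eq : ∀ s t : ℝ, 0 ≤ s → s ≤ t → t ≤ τ → ∀ x : X,
    V t s x = T (t - s) x + ∫ σ in s..t, T (t - σ) (G σ (V σ s x))

end ControlToState

end

/-! Everything rests on Gronwall's inequality for Volterra equations and on two fixed-point
arguments.

Horizons. On a ball of `C([0,τ];X)` of radius slightly above `M‖x₀‖` the mild-solution map is a
contraction once `τ` is small (`exists_mildSolution_of_small`). By Hölder the control contributes at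
most a multiple of `τ ^ (1 - 1/p) * R`, which tends to `0` because `p > 1`, so one `τ` serves all
controls and designs (`exists_admissibleHorizon`). Uniqueness holds on any horizon: two solutions
are bounded, hence lie in a ball where `F` is Lipschitz, and Gronwall applies.

Linear theory. Along a fixed trajectory `G(s) = F'(xo(s))` is bounded, but `s ↦ G(s)` need not be
continuous even in the strong sense. It is a pointwise limit of continuous difference quotients, so
the integrands are measurable. The integral equation for the evolution operator is then solved by a
Neumann series in an exponentially weighted sup norm (`exists_evolution_family`), and Gronwall
yields the composition law (`exists_evolutionOperator`). Fubini on a triangle shows that `∫ V(t,s)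
f(s) ds` is the mild solution of the linearized equation (`IsEvolutionOperator.isMildSolution`).

Differentiability. Let `d = ε⁻¹(xε - xo) - y`, with `y` the linearized solution. Inserting the
intermediate point `xo + εy` bounds the integrand of the equation for `d` by a multiple of `‖d‖`
plus the residual of `F` at `xo(s)` in the direction `y(s)`. At each time the direction is fixed, so
Gâteaux differentiability makes the residual tend to `0` pointwise; it is bounded, so its integral
tends to `0` and Gronwall gives `d → 0` uniformly on `[0,τ]` (`eventually_norm_slope_sub_le`), hence
in `Lᵖ`. -/

namespace ControlToState

/-! ### Gronwall estimates and a continuation principle -/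

section Gronwall

/-- The right-hand side `Φ(t) = c + K ∫ φ` satisfies `Φ' = K φ ≤ K Φ`, so the differential Gronwall
inequality applies to `Φ`. Extending `φ` by its end values makes `Φ` differentiable everywhere, end
points included. -/
theorem le_exp_of_le_integral {φ : ℝ → ℝ} {a b c K : ℝ} (hK : 0 ≤ K)
    (hφ : ContinuousOn φ (Icc a b)) (h : ∀ t ∈ Icc a b, φ t ≤ c + K * ∫ s in a..t, φ s) :
    ∀ t ∈ Icc a b, φ t ≤ c * Real.exp (K * (t - a)) := by
  intro t ht
  have hab : a ≤ b := ht.1.trans ht.2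
  set ψ : ℝ → ℝ := IccExtend hab ((Icc a b).domRestrict φ) with hψ
  have hψc : Continuous ψ := continuous_IccExtend_iff.2 hφ.domRestrict
  have hψφ : ∀ s ∈ Icc a b, ψ s = φ s := fun s hs => IccExtend_of_mem hab _ hs
  have hint : ∀ t ∈ Icc a b, ∫ s in a..t, ψ s = ∫ s in a..t, φ s := by
    intro t ht
    refine intervalIntegral.integral_congr fun s hs => hψφ s ?_
    rw [uIcc_of_le ht.1] at hs
    exact ⟨hs.1, hs.2.trans ht.2⟩
  have hder : ∀ s, HasDerivAt (fun t => c + K * ∫ s in a..t, ψ s) (K * ψ s) s := fun s =>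
    ((intervalIntegral.integral_hasDerivAt_right (hψc.intervalIntegrable _ _)
      (hψc.stronglyMeasurableAtFilter _ _) hψc.continuousAt).const_mul K).const_add c
  have key := le_gronwallBound_of_liminf_deriv_right_le (f := fun t => c + K * ∫ s in a..t, ψ s)
    (f' := fun s => K * ψ s) (δ := c) (K := K) (ε := 0) (a := a) (b := b)
    (fun s _ => (hder s).continuousAt.continuousWithinAt)
    (fun s _ r hr => ((hder s).hasDerivWithinAt (s := Ici s)).liminf_right_slope_le hr)
    (by simp) (fun s hs => by
      have := h s (Ico_subset_Icc_self hs)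
      rw [← hint s (Ico_subset_Icc_self hs), ← hψφ s (Ico_subset_Icc_self hs)] at this
      rw [add_zero]
      exact mul_le_mul_of_nonneg_left this hK) t ht
  rw [gronwallBound_ε0] at key
  refine (h t ht).trans ?_
  rw [← hint t ht]
  exact key

variable {X : Type*} [NormedAddCommGroup X] [NormedSpace ℝ X]

/-- The common form of the estimates below: `ρ = 0` gives uniqueness, a small integral of `ρ` gives
stability. -/
theorem norm_le_of_eq_volterra_integral {d : ℝ → X} {k : ℝ → ℝ → X} {ρ : ℝ → ℝ} {a b K : ℝ}
    (hK : 0 ≤ K) (hd : ContinuousOn d (Icc a b)) (hρ : IntervalIntegrable ρ volume a b)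
    (hρ0 : ∀ s, 0 ≤ ρ s) (heq : ∀ t ∈ Icc a b, d t = ∫ s in a..t, k t s)
    (hk : ∀ t ∈ Icc a b, ∀ s ∈ Ioc a t, ‖k t s‖ ≤ K * ‖d s‖ + ρ s) :
    ∀ t ∈ Icc a b, ‖d t‖ ≤ (∫ s in a..b, ρ s) * Real.exp (K * (t - a)) := by
  refine le_exp_of_le_integral hK hd.norm fun t ht => ?_
  have hsub : uIcc a t ⊆ uIcc a b := by
    rw [uIcc_of_le ht.1, uIcc_of_le (ht.1.trans ht.2)]
    exact Icc_subset_Icc_right ht.2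
  have hdi : IntervalIntegrable (fun s => K * ‖d s‖) volume a t :=
    ((hd.norm.mono (Icc_subset_Icc_right ht.2)).intervalIntegrable_of_Icc ht.1).const_mul K
  have hρt := hρ.mono_set hsub
  calc ‖d t‖ = ‖∫ s in a..t, k t s‖ := by rw [heq t ht]
    _ ≤ ∫ s in a..t, (K * ‖d s‖ + ρ s) :=
      intervalIntegral.norm_integral_le_of_norm_le ht.1 (ae_of_all _ (hk t ht)) (hdi.add hρt)
    _ = (∫ s in a..t, ρ s) + K * ∫ s in a..t, ‖d s‖ := by
      rw [intervalIntegral.integral_add hdi hρt, intervalIntegral.integral_const_mul, add_comm]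
    _ ≤ (∫ s in a..b, ρ s) + K * ∫ s in a..t, ‖d s‖ := by
      gcongr
      exact intervalIntegral.integral_mono_interval le_rfl ht.1 ht.2 (ae_of_all _ hρ0) hρ

/-- A continuous function which starts below `1`, and is below `1` at every time up to which it
has been at most `1`, stays below `1`. -/
theorem lt_one_of_continuation {φ : ℝ → ℝ} {a b : ℝ} (hφ : ContinuousOn φ (Icc a b))
    (h : ∀ t ∈ Icc a b, (∀ s ∈ Ico a t, φ s < 1) → φ t ≤ 1 → φ t < 1) (ha : φ a < 1) :
    ∀ t ∈ Icc a b, φ t < 1 := by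
  by_contra! hne
  obtain ⟨t₁, ht₁, h₁⟩ := hne
  have hcl : IsClosed (Icc a b ∩ φ ⁻¹' Ici 1) := hφ.preimage_isClosed_of_isClosed isClosed_Icc
    isClosed_Ici
  -- The first exit time: before it `φ < 1`, so `φ t ≤ 1` by continuity from the left, and the
  -- hypothesis then contradicts `φ t ≥ 1`.
  obtain ⟨t, ⟨htI, ht1⟩, hmin⟩ := (isCompact_Icc.of_isClosed_subset hcl inter_subset_left)
    |>.exists_isLeast ⟨t₁, ht₁, h₁⟩
  have hbefore : ∀ s ∈ Ico a t, φ s < 1 := fun s hs => by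
    by_contra! hs1
    exact absurd (hmin ⟨⟨hs.1, hs.2.le.trans htI.2⟩, hs1⟩) (not_le.2 hs.2)
  have hat : a < t := lt_of_le_of_ne htI.1 (by rintro rfl; exact absurd ht1 (not_le.2 ha))
  refine absurd ht1 (not_le.2 (h t htI hbefore ?_))
  have hcont : ContinuousWithinAt φ (Ico a t) t :=
    (hφ t htI).mono fun s hs => ⟨hs.1, hs.2.le.trans htI.2⟩
  have : (𝓝[Ico a t] t).NeBot := by
    rw [nhdsWithin_Ico_eq_nhdsLT hat]; infer_instance
  exact le_of_tendsto hcont (eventually_nhdsWithin_of_forall fun s hs => (hbefore s hs).le)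

end Gronwall

/-! ### Continuity of integrals with moving limits -/

section Convolution

variable {X : Type*} [NormedAddCommGroup X] [NormedSpace ℝ X]

/-- Dominated convergence: the truncated integrand is continuous in `q` at `q₀` for every `σ` other
than the two end points `a q₀` and `b q₀`, which form a null set. -/
theorem continuous_setIntegral_Ioc {P : Type*} [TopologicalSpace P] [FirstCountableTopology P]
    {μ : Measure ℝ} [NullSingletonClass μ] {a b : P → ℝ} (ha : Continuous a) (hb : Continuous b)
    {h : P → ℝ → X} {g : ℝ → ℝ} (hmeas : ∀ q, AEStronglyMeasurable (h q) μ)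
    (hbound : ∀ q σ, ‖h q σ‖ ≤ g σ) (hg : Integrable g μ)
    (hcont : ∀ σ, Continuous fun q => h q σ) :
    Continuous fun q => ∫ σ in Ioc (a q) (b q), h q σ ∂μ := by
  simp_rw [← integral_indicator measurableSet_Ioc]
  refine continuous_iff_continuousAt.2 fun q₀ => continuousAt_of_dominated (bound := g)
    (Eventually.of_forall fun q => (hmeas q).indicator measurableSet_Ioc)
    (Eventually.of_forall fun q => ae_of_all _ fun σ =>
      (norm_indicator_le_norm_self _ _).trans (hbound q σ)) hg ?_
  have hne : ∀ c : ℝ, ∀ᵐ σ ∂μ, σ ≠ c := fun c => by simp [ae_iff]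
  filter_upwards [hne (a q₀), hne (b q₀)] with σ hσa hσb
  by_cases hσ : a q₀ < σ ∧ σ < b q₀
  · refine (hcont σ).continuousAt.congr ?_
    filter_upwards [ha.continuousAt.eventually_lt continuousAt_const hσ.1,
      continuousAt_const.eventually_lt hb.continuousAt hσ.2] with q h1 h2
    rw [indicator_of_mem (show σ ∈ Ioc (a q) (b q) from ⟨h1, h2.le⟩)]
  · refine (continuousAt_const (y := (0 : X))).congr ?_
    rcases lt_or_gt_of_ne hσa with h1 | h1
    · filter_upwards [continuousAt_const.eventually_lt ha.continuousAt h1] with q hq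
      rw [indicator_of_notMem fun hm : σ ∈ Ioc (a q) (b q) => absurd hm.1 (not_lt.2 hq.le)]
    · rcases lt_or_gt_of_ne hσb with h2 | h2
      · exact absurd ⟨h1, h2⟩ hσ
      · filter_upwards [hb.continuousAt.eventually_lt continuousAt_const h2] with q hq
        rw [indicator_of_notMem fun hm : σ ∈ Ioc (a q) (b q) => absurd hm.2 (not_le.2 hq)]

theorem setIntegral_timeMeasure {f : ℝ → X} {s t τ : ℝ} (hs : 0 ≤ s) (hst : s ≤ t) (ht : t ≤ τ) :
    ∫ σ in Ioc s t, f σ ∂(timeMeasure τ) = ∫ σ in s..t, f σ := by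
  rw [intervalIntegral.integral_of_le hst, timeMeasure,
    Measure.restrict_restrict_of_subset (Ioc_subset_Ioc hs ht)]

/-- The uniform bound makes the operators equi-Lipschitz, which upgrades strong continuity to joint
continuity. -/
theorem continuous_apply_of_bound {P : Type*} [TopologicalSpace P] {S : P → X →L[ℝ] X} {M : ℝ}
    (hM : ∀ t, ‖S t‖ ≤ M) (hS : ∀ x, Continuous fun t => S t x) :
    Continuous fun q : P × X => S q.1 q.2 := by
  have := continuous_prod_of_continuous_lipschitzWith' (fun q : P × X => S q.1 q.2) M.toNNReal
    (fun t => (S t).lipschitz.weaken (by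
      rw [← norm_toNNReal]; exact Real.toNNReal_le_toNNReal (hM t))) hS
  exact this

end Convolution

/-! ### Bounded extension of the semigroup to the line -/

section Semigroup

variable {X : Type*} [NormedAddCommGroup X] [NormedSpace ℝ X]

/-- A bounded, strongly continuous family on the whole line which agrees with the semigroup
on `[0,τ]`. -/
theorem IsStronglyContinuousSemigroup.exists_extension [CompleteSpace X] {T : ℝ → X →L[ℝ] X}
    (hT : IsStronglyContinuousSemigroup T) {τ : ℝ} (hτ : 0 ≤ τ) :
    ∃ (S : ℝ → X →L[ℝ] X) (M : ℝ), 0 ≤ M ∧ (∀ t, ‖S t‖ ≤ M) ∧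
      (Continuous fun q : ℝ × X => S q.1 q.2) ∧ ∀ t ∈ Icc 0 τ, S t = T t := by
  have hc : ∀ x, Continuous fun t => T (projIcc 0 τ hτ t) x := fun x =>
    ((hT.continuousOn x).mono fun t ht => ht.1).domRestrict.comp (continuous_projIcc (h := hτ))
  -- Each orbit is bounded on the compact interval, so the operators are uniformly bounded there.
  obtain ⟨M, hM⟩ := banach_steinhaus (g := fun t : Icc (0 : ℝ) τ => T t) fun x => by
    obtain ⟨C, hC⟩ := isCompact_Icc.exists_bound_of_continuousOn
      ((hT.continuousOn x).mono fun t (ht : t ∈ Icc 0 τ) => ht.1)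
    exact ⟨C, fun t => hC t t.2⟩
  refine ⟨fun t => T (projIcc 0 τ hτ t), M, (norm_nonneg _).trans (hM ⟨0, le_rfl, hτ⟩),
    fun t => hM _, continuous_apply_of_bound (fun t => hM _) hc, fun t ht => ?_⟩
  simp [projIcc_of_mem hτ ht]

end Semigroup

/-! ### The evolution family as a Neumann series -/

section Evolution

open scoped BoundedContinuousFunction

variable {X : Type*} [NormedAddCommGroup X] [NormedSpace ℝ X]

/-- `(s, x) ↦ G(s) x` is the pointwise limit of a sequence of continuous functions. -/
def IsLimitOfContinuous (G : ℝ → X →L[ℝ] X) : Prop :=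
  ∃ g : ℕ → ℝ × X → X, (∀ n, Continuous (g n)) ∧
    ∀ s x, Tendsto (fun n => g n (s, x)) atTop (𝓝 (G s x))

/-- This replaces continuity of `s ↦ G(s)`, which is not available when `G(s) = F'(x(s))`. Joint
approximation in `(s, x)` lets a varying vector be inserted. -/
theorem IsLimitOfContinuous.aestronglyMeasurable {G : ℝ → X →L[ℝ] X} (hG : IsLimitOfContinuous G)
    {α : Type*} [MeasurableSpace α] {ν : Measure α} {φ : α → ℝ} (hφ : AEStronglyMeasurable φ ν)
    {w : α → X} (hw : AEStronglyMeasurable w ν) :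
    AEStronglyMeasurable (fun a => G (φ a) (w a)) ν := by
  obtain ⟨g, hg, hlim⟩ := hG
  exact aestronglyMeasurable_of_tendsto_ae atTop
    (fun n => (hg n).comp_aestronglyMeasurable (hφ.prodMk hw)) (ae_of_all _ fun a => hlim _ _)

/-- The weight `exp(-c(t - σ))` brings the norm of the Volterra operator down to `M C / c`, small
for large `c`. The operator acts on functions on the whole plane: the time measure is carried by
`(0,τ]`, and `max` keeps the weight at most `1` everywhere. -/
theorem exists_volterra_operator {S : ℝ → X →L[ℝ] X} {M : ℝ} (hM0 : 0 ≤ M)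
    (hM : ∀ t, ‖S t‖ ≤ M) (hS : Continuous fun q : ℝ × X => S q.1 q.2) {G : ℝ → X →L[ℝ] X} {C : ℝ}
    (hC0 : 0 ≤ C) (hC : ∀ t, ‖G t‖ ≤ C) (hG : IsLimitOfContinuous G) (τ : ℝ) {c : ℝ}
    (hc : 0 < c) :
    ∃ W : (ℝ × ℝ →ᵇ X) →L[ℝ] (ℝ × ℝ →ᵇ X), ‖W‖ ≤ M * C / c ∧ ∀ v q,
      W v q = ∫ σ in Ioc q.2 q.1,
        Real.exp (-c * max (q.1 - σ) 0) • S (q.1 - σ) (G σ (v (σ, q.2))) ∂(timeMeasure τ) := by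
  set h : (ℝ × ℝ →ᵇ X) → ℝ × ℝ → ℝ → X := fun v q σ =>
    Real.exp (-c * max (q.1 - σ) 0) • S (q.1 - σ) (G σ (v (σ, q.2))) with hh
  have hmeas : ∀ v q, AEStronglyMeasurable (h v q) (timeMeasure τ) := fun v q => by
    have h1 : AEStronglyMeasurable (fun σ => G σ (v (σ, q.2))) (timeMeasure τ) :=
      hG.aestronglyMeasurable aestronglyMeasurable_id
        (v.continuous.comp (by fun_prop : Continuous fun σ : ℝ => (σ, q.2))).aestronglyMeasurable
    have h2 : AEStronglyMeasurable (fun σ => S (q.1 - σ) (G σ (v (σ, q.2)))) (timeMeasure τ) :=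
      hS.comp_aestronglyMeasurable
        ((by fun_prop : Continuous fun σ : ℝ => q.1 - σ).aestronglyMeasurable.prodMk h1)
    exact (by fun_prop : Continuous fun σ : ℝ =>
      Real.exp (-c * max (q.1 - σ) 0)).aestronglyMeasurable.smul h2
  have hb : ∀ v q σ, ‖h v q σ‖ ≤ M * C * ‖v‖ * Real.exp (-c * max (q.1 - σ) 0) := fun v q σ => by
    have : ‖S (q.1 - σ) (G σ (v (σ, q.2)))‖ ≤ M * C * ‖v‖ :=
      calc _ ≤ M * (C * ‖v‖) := (S _).le_of_opNorm_le_of_le (hM _)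
            ((G σ).le_of_opNorm_le_of_le (hC σ) (v.norm_coe_le_norm _))
        _ = _ := by ring
    rw [hh, norm_smul, Real.norm_of_nonneg (Real.exp_pos _).le, mul_comm]
    exact mul_le_mul_of_nonneg_right this (Real.exp_pos _).le
  have hb' : ∀ v q σ, ‖h v q σ‖ ≤ M * C * ‖v‖ := fun v q σ =>
    (hb v q σ).trans (mul_le_of_le_one_right (by positivity)
      (Real.exp_le_one_iff.2 (by nlinarith [le_max_right (q.1 - σ) 0])))
  have hcont : ∀ v, Continuous fun q : ℝ × ℝ => ∫ σ in Ioc q.2 q.1, h v q σ ∂(timeMeasure τ) :=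
    fun v => continuous_setIntegral_Ioc continuous_snd continuous_fst (hmeas v) (hb' v)
      (integrable_const _) fun σ => by
        have : Continuous fun q : ℝ × ℝ => S (q.1 - σ) (G σ (v (σ, q.2))) :=
          hS.comp (by fun_prop : Continuous fun q : ℝ × ℝ => (q.1 - σ, G σ (v (σ, q.2))))
        exact (by fun_prop : Continuous fun q : ℝ × ℝ =>
          Real.exp (-c * max (q.1 - σ) 0)).smul this
  have hbound : ∀ v q, ‖∫ σ in Ioc q.2 q.1, h v q σ ∂(timeMeasure τ)‖ ≤ M * C / c * ‖v‖ := by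
    intro v q
    -- The domain is enlarged to `(-∞, t]`, with `t = q.1`, where the weight `exp(-c(t - σ))` has
    -- integral exactly `1 / c`.
    have hint := (integrableOn_exp_mul_Iic hc q.1).const_mul (M * C * ‖v‖ * Real.exp (-c * q.1))
    have hle : (timeMeasure τ).restrict (Ioc q.2 q.1) ≤ volume.restrict (Iic q.1) :=
      Measure.restrict_mono (fun σ hσ => hσ.2) Measure.restrict_le_self
    calc _ ≤ ∫ σ in Ioc q.2 q.1, M * C * ‖v‖ * Real.exp (-c * q.1) * Real.exp (c * σ)
          ∂(timeMeasure τ) := by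
          refine norm_integral_le_of_norm_le (hint.mono_measure hle)
            ((ae_restrict_iff' measurableSet_Ioc).2 (ae_of_all _ fun σ hσ => (hb v q σ).trans ?_))
          rw [max_eq_left (sub_nonneg.2 hσ.2), mul_assoc (M * C * ‖v‖), ← Real.exp_add]
          apply le_of_eq; congr 2; ring
      _ ≤ ∫ σ in Iic q.1, M * C * ‖v‖ * Real.exp (-c * q.1) * Real.exp (c * σ) :=
          integral_mono_measure hle (ae_of_all _ fun σ => by positivity) hint
      _ = M * C / c * ‖v‖ := by
          rw [integral_const_mul, integral_exp_mul_Iic hc, mul_assoc (M * C * ‖v‖), ← mul_div_assoc,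
            ← Real.exp_add]
          simp
          ring
  have hint : ∀ v q, Integrable (h v q) ((timeMeasure τ).restrict (Ioc q.2 q.1)) := fun v q =>
    (Integrable.of_bound (hmeas v q) _ (ae_of_all _ (hb' v q))).mono_measure
      Measure.restrict_le_self
  let W₀ : (ℝ × ℝ →ᵇ X) →ₗ[ℝ] (ℝ × ℝ →ᵇ X) :=
    { toFun := fun v => BoundedContinuousFunction.ofNormedAddCommGroup _ (hcont v) _ (hbound v)
      map_add' := fun v w => by
        ext q
        simp only [BoundedContinuousFunction.coe_ofNormedAddCommGroup,
          BoundedContinuousFunction.coe_add, Pi.add_apply]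
        rw [← integral_add (hint v q) (hint w q)]
        simp [hh]
      map_smul' := fun a v => by
        ext q
        simp only [BoundedContinuousFunction.coe_ofNormedAddCommGroup,
          BoundedContinuousFunction.coe_smul, RingHom.id_apply]
        rw [← integral_smul]
        simp [hh, smul_comm a] }
  refine ⟨W₀.mkContinuous (M * C / c) fun v => ?_, W₀.mkContinuous_norm_le (by positivity) _,
    fun v q => rfl⟩
  exact (BoundedContinuousFunction.norm_le (by positivity)).2 (hbound v)

/-- The weighted unknown `exp(-c(t - s)) V(t,s) x` solves `z = J x + W z` with `‖W‖ < 1`. Hence `z =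
(1 - W)⁻¹ J x` is linear and bounded in `x`, and undoing the weight gives `V`. -/
theorem exists_evolution_family [CompleteSpace X] {S : ℝ → X →L[ℝ] X} {M : ℝ} (hM0 : 0 ≤ M)
    (hM : ∀ t, ‖S t‖ ≤ M) (hS : Continuous fun q : ℝ × X => S q.1 q.2) {G : ℝ → X →L[ℝ] X} {C : ℝ}
    (hC0 : 0 ≤ C) (hC : ∀ t, ‖G t‖ ≤ C) (hG : IsLimitOfContinuous G) (τ : ℝ) :
    ∃ (V : ℝ → ℝ → X →L[ℝ] X) (D : ℝ), 0 ≤ D ∧ (∀ t s, ‖V t s‖ ≤ D) ∧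
      (Continuous fun q : (ℝ × ℝ) × X => V q.1.1 q.1.2 q.2) ∧
      ∀ s t : ℝ, 0 ≤ s → s ≤ t → t ≤ τ → ∀ x : X,
        V t s x = S (t - s) x + ∫ σ in s..t, S (t - σ) (G σ (V σ s x)) := by
  set c : ℝ := 2 * (M * C) + 1 with hcdef
  have hc : 0 < c := by positivity
  obtain ⟨W, hWn, hW⟩ := exists_volterra_operator hM0 hM hS hC0 hC hG τ hc
  have hW1 : ‖W‖ < 1 := hWn.trans_lt (by rw [div_lt_one hc]; nlinarith [mul_nonneg hM0 hC0])
  have hJc : ∀ x : X, Continuous fun q : ℝ × ℝ =>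
      Real.exp (-c * max (q.1 - q.2) 0) • S (q.1 - q.2) x := fun x =>
    (by fun_prop : Continuous fun q : ℝ × ℝ => Real.exp (-c * max (q.1 - q.2) 0)).smul
      (hS.comp (by fun_prop : Continuous fun q : ℝ × ℝ => (q.1 - q.2, x)))
  have hJb : ∀ (x : X) (q : ℝ × ℝ),
      ‖Real.exp (-c * max (q.1 - q.2) 0) • S (q.1 - q.2) x‖ ≤ M * ‖x‖ := fun x q => by
    rw [norm_smul, Real.norm_of_nonneg (Real.exp_pos _).le]
    exact (mul_le_of_le_one_left (norm_nonneg _) (Real.exp_le_one_iff.2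
      (by nlinarith [le_max_right (q.1 - q.2) 0]))).trans ((S _).le_of_opNorm_le (hM _) x)
  let J₀ : X →ₗ[ℝ] (ℝ × ℝ →ᵇ X) :=
    { toFun := fun x => BoundedContinuousFunction.ofNormedAddCommGroup _ (hJc x) _ (hJb x)
      map_add' := fun x y => by ext q; simp
      map_smul' := fun a x => by ext q; simp [smul_comm a] }
  let J : X →L[ℝ] (ℝ × ℝ →ᵇ X) := J₀.mkContinuous M fun x =>
    (BoundedContinuousFunction.norm_le (by positivity)).2 (hJb x)
  have hJ : ∀ x q, J x q = Real.exp (-c * max (q.1 - q.2) 0) • S (q.1 - q.2) x := fun x q => rfl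
  let Z : X →L[ℝ] (ℝ × ℝ →ᵇ X) :=
    ((↑(Units.oneSub W hW1)⁻¹ : (ℝ × ℝ →ᵇ X) →L[ℝ] (ℝ × ℝ →ᵇ X))).comp J
  have hZ : ∀ x, Z x = J x + W (Z x) := fun x => by
    have : (1 - W) * (↑(Units.oneSub W hW1)⁻¹ : (ℝ × ℝ →ᵇ X) →L[ℝ] (ℝ × ℝ →ᵇ X)) = 1 :=
      (Units.oneSub W hW1).mul_inv
    have h2 := congrArg (fun L : (ℝ × ℝ →ᵇ X) →L[ℝ] (ℝ × ℝ →ᵇ X) => L (J x)) this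
    exact sub_eq_iff_eq_add.1 h2
  -- The exponent is clipped to `[0, τ]` so that `V` is bounded on the whole plane; for `0 ≤ s ≤ t ≤
  -- τ` the clipping does nothing.
  let V : ℝ → ℝ → X →L[ℝ] X := fun t s => Real.exp (c * max 0 (min (t - s) τ)) •
    (BoundedContinuousFunction.evalCLM ℝ (t, s)).comp Z
  have hV : ∀ t s x, V t s x = Real.exp (c * max 0 (min (t - s) τ)) • Z x (t, s) :=
    fun t s x => rfl
  refine ⟨V, Real.exp (c * max 0 τ) * ‖Z‖, by positivity, fun t s => ?_, ?_, ?_⟩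
  · refine ContinuousLinearMap.opNorm_le_bound _ (by positivity) fun x => ?_
    rw [hV, norm_smul, Real.norm_of_nonneg (Real.exp_pos _).le, mul_assoc]
    refine mul_le_mul ?_ (((Z x).norm_coe_le_norm _).trans (Z.le_opNorm x)) (norm_nonneg _)
      (Real.exp_pos _).le
    refine Real.exp_le_exp.2 (mul_le_mul_of_nonneg_left ?_ hc.le)
    exact max_le_max le_rfl (min_le_right _ _)
  · simp only [hV]
    refine (by fun_prop : Continuous fun q : (ℝ × ℝ) × X =>
      Real.exp (c * max 0 (min (q.1.1 - q.1.2) τ))).smul ?_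
    exact (continuous_eval (F := ℝ × ℝ →ᵇ X)).comp
      (by fun_prop : Continuous fun q : (ℝ × ℝ) × X => (Z q.2, (q.1.1, q.1.2)))
  · intro s t hs hst ht x
    have hclip : ∀ σ, s ≤ σ → σ ≤ t → max 0 (min (σ - s) τ) = σ - s := fun σ h1 h2 => by
      rw [min_eq_left (by linarith), max_eq_right (by linarith)]
    rw [hV, hclip t hst le_rfl, hZ, BoundedContinuousFunction.coe_add, Pi.add_apply, hJ, hW,
      smul_add, setIntegral_timeMeasure hs hst ht, ← intervalIntegral.integral_smul]
    congr 1
    · rw [max_eq_left (sub_nonneg.2 hst), smul_smul, ← Real.exp_add]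
      simp
    · refine intervalIntegral.integral_congr fun σ hσ => ?_
      rw [uIcc_of_le hst] at hσ
      simp only [hV]
      rw [hclip σ hσ.1 hσ.2, map_smul, map_smul, smul_smul, max_eq_left (sub_nonneg.2 hσ.2),
        ← Real.exp_add]
      congr 2
      ring

end Evolution

/-! ### Stability and uniqueness of mild solutions -/

section MildSolutions

variable {X : Type*} [NormedAddCommGroup X] [NormedSpace ℝ X]

theorem IsStronglyContinuousSemigroup.exists_norm_le [CompleteSpace X] {T : ℝ → X →L[ℝ] X}
    (hT : IsStronglyContinuousSemigroup T) {τ : ℝ} (hτ : 0 ≤ τ) :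
    ∃ M : ℝ, 0 ≤ M ∧ ∀ t ∈ Icc 0 τ, ‖T t‖ ≤ M := by
  obtain ⟨S, M, hM0, hM, -, hST⟩ := hT.exists_extension hτ
  exact ⟨M, hM0, fun t ht => hST t ht ▸ hM t⟩

theorem IsStronglyContinuousSemigroup.intervalIntegrable [CompleteSpace X] {T : ℝ → X →L[ℝ] X}
    (hT : IsStronglyContinuousSemigroup T) {s t : ℝ} (hst : s ≤ t) {f : ℝ → X}
    (hf : IntegrableOn f (Ioc s t)) :
    IntervalIntegrable (fun σ => T (t - σ) (f σ)) volume s t := by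
  obtain ⟨S, M, hM0, hM, hS, hST⟩ := hT.exists_extension (sub_nonneg.2 hst)
  rw [intervalIntegrable_iff_integrableOn_Ioc_of_le hst]
  have h1 : IntegrableOn (fun σ => S (t - σ) (f σ)) (Ioc s t) :=
    (hf.norm.const_mul M).mono'
      (hS.comp_aestronglyMeasurable
        ((by fun_prop : Continuous fun σ : ℝ => t - σ).aestronglyMeasurable.prodMk hf.1))
      (ae_of_all _ fun σ => (S _).le_of_opNorm_le (hM _) _)
  refine h1.congr_fun (fun σ hσ => ?_) measurableSet_Ioc
  simp only [hST (t - σ) ⟨sub_nonneg.2 hσ.2, by linarith [hσ.1]⟩]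

theorem IsMildSolution.mono {T : ℝ → X →L[ℝ] X} {N : ℝ → X → X} {f : ℝ → X} {x₀ : X} {τ b : ℝ}
    {x : ℝ → X} (h : IsMildSolution T N f x₀ τ x) (hb : b ≤ τ) : IsMildSolution T N f x₀ b x :=
  have hsub : Icc 0 b ⊆ Icc 0 τ := Icc_subset_Icc_right hb
  ⟨h.continuousOn.mono hsub, fun t ht => h.integrable_perturbation t (hsub ht),
    fun t ht => h.integrable_forcing t (hsub ht), fun t ht => h.eq t (hsub ht)⟩

/-- Allows a trajectory given on `[0,τ]` to be replaced by its continuous extension to the line, for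
which `G` is defined and bounded at all times. `IsEvolutionOperator.congr` plays the same role. -/
theorem IsMildSolution.congr_perturbation {T : ℝ → X →L[ℝ] X} {N N' : ℝ → X → X} {f : ℝ → X}
    {x₀ : X} {τ : ℝ} {x : ℝ → X} (h : IsMildSolution T N f x₀ τ x)
    (hN : ∀ s ∈ Icc 0 τ, ∀ z, N s z = N' s z) : IsMildSolution T N' f x₀ τ x := by
  have hcongr : ∀ t ∈ Icc 0 τ, EqOn (fun s => T (t - s) (N s (x s)))
      (fun s => T (t - s) (N' s (x s))) (uIcc 0 t) := fun t ht s hs => by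
    rw [uIcc_of_le ht.1] at hs
    simp only [hN s ⟨hs.1, hs.2.trans ht.2⟩]
  refine ⟨h.continuousOn, fun t ht => (h.integrable_perturbation t ht).congr
    ((hcongr t ht).mono uIoc_subset_uIcc), h.integrable_forcing, fun t ht => ?_⟩
  rw [h.eq t ht, intervalIntegral.integral_congr (hcongr t ht)]

/-- The Lipschitz bound is required only along the two trajectories, so a locally Lipschitz
nonlinearity is covered as soon as both are known to stay in a ball. -/
theorem IsMildSolution.norm_sub_le {T : ℝ → X →L[ℝ] X} {N : ℝ → X → X} {f f' : ℝ → X} {x₀ : X}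
    {τ M L : ℝ} {x x' : ℝ → X} (h : IsMildSolution T N f x₀ τ x)
    (h' : IsMildSolution T N f' x₀ τ x') (hM0 : 0 ≤ M) (hM : ∀ t ∈ Icc 0 τ, ‖T t‖ ≤ M)
    (hL0 : 0 ≤ L) (hL : ∀ s ∈ Icc 0 τ, ‖N s (x s) - N s (x' s)‖ ≤ L * ‖x s - x' s‖)
    (hf : IntervalIntegrable (fun s => f s - f' s) volume 0 τ) :
    ∀ t ∈ Icc 0 τ, ‖x t - x' t‖ ≤
      (∫ s in (0 : ℝ)..τ, M * ‖f s - f' s‖) * Real.exp (M * L * t) := by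
  have key := norm_le_of_eq_volterra_integral (d := fun t => x t - x' t) (a := 0) (b := τ)
    (K := M * L) (ρ := fun s => M * ‖f s - f' s‖)
    (k := fun t s => T (t - s) (N s (x s) - N s (x' s)) + T (t - s) (f s - f' s))
    (by positivity) (h.continuousOn.sub h'.continuousOn) (hf.norm.const_mul M)
    (fun s => by positivity) (fun t ht => ?_) (fun t ht s hs => ?_)
  · simpa using key
  · simp only [map_sub]
    have h1 := h.integrable_perturbation t ht
    have h2 := h'.integrable_perturbation t ht
    have h3 := h.integrable_forcing t ht
    have h4 := h'.integrable_forcing t ht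
    rw [intervalIntegral.integral_add (h1.sub h2) (h3.sub h4), intervalIntegral.integral_sub h1 h2,
      intervalIntegral.integral_sub h3 h4, h.eq t ht, h'.eq t ht]
    abel
  · have hTs := hM (t - s) ⟨sub_nonneg.2 hs.2, by linarith [hs.1, ht.2]⟩
    have hs' : s ∈ Icc 0 τ := ⟨hs.1.le, hs.2.trans ht.2⟩
    refine (norm_add_le _ _).trans (add_le_add ?_ ((T _).le_of_opNorm_le hTs _))
    rw [mul_assoc]
    exact (T _).le_of_opNorm_le_of_le hTs (hL s hs')

theorem IsMildSolution.eqOn {T : ℝ → X →L[ℝ] X} {N : ℝ → X → X} {f : ℝ → X} {x₀ : X}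
    {τ M L : ℝ} {x x' : ℝ → X} (h : IsMildSolution T N f x₀ τ x)
    (h' : IsMildSolution T N f x₀ τ x') (hM0 : 0 ≤ M) (hM : ∀ t ∈ Icc 0 τ, ‖T t‖ ≤ M)
    (hL0 : 0 ≤ L) (hL : ∀ s ∈ Icc 0 τ, ‖N s (x s) - N s (x' s)‖ ≤ L * ‖x s - x' s‖) :
    EqOn x x' (Icc 0 τ) := fun t ht => by
  have := h.norm_sub_le h' hM0 hM hL0 hL (by simp) t ht
  simpa [sub_eq_zero] using this

end MildSolutions

/-! ### Composition law and variation of constants -/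

section EvolutionOperators

variable {X : Type*} [NormedAddCommGroup X] [NormedSpace ℝ X]

theorem IsEvolutionOperator.congr {T : ℝ → X →L[ℝ] X} {G G' : ℝ → X →L[ℝ] X} {τ : ℝ}
    {V : ℝ → ℝ → X →L[ℝ] X} (h : IsEvolutionOperator T G τ V)
    (hG : ∀ s ∈ Icc 0 τ, G s = G' s) : IsEvolutionOperator T G' τ V := by
  have hcongr : ∀ s t : ℝ, 0 ≤ s → s ≤ t → t ≤ τ → ∀ x : X,
      EqOn (fun σ => T (t - σ) (G σ (V σ s x))) (fun σ => T (t - σ) (G' σ (V σ s x)))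
        (uIcc s t) := fun s t hs hst ht x σ hσ => by
    rw [uIcc_of_le hst] at hσ
    simp only [hG σ ⟨hs.trans hσ.1, hσ.2.trans ht⟩]
  refine ⟨h.refl, h.comp, h.continuousOn, fun s t hs hst ht x => (h.integrable s t hs hst ht x).congr
    ((hcongr s t hs hst ht x).mono uIoc_subset_uIcc), fun s t hs hst ht x => ?_⟩
  rw [h.eq s t hs hst ht x, intervalIntegral.integral_congr (hcongr s t hs hst ht x)]

theorem exists_evolutionOperator [CompleteSpace X] {T : ℝ → X →L[ℝ] X}
    (hT : IsStronglyContinuousSemigroup T) {G : ℝ → X →L[ℝ] X} {C : ℝ}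
    (hC0 : 0 ≤ C) (hC : ∀ t, ‖G t‖ ≤ C) (hG : IsLimitOfContinuous G) {τ : ℝ} (hτ : 0 ≤ τ) :
    ∃ (V : ℝ → ℝ → X →L[ℝ] X) (D : ℝ), 0 ≤ D ∧ (∀ t s, ‖V t s‖ ≤ D) ∧
      (Continuous fun q : (ℝ × ℝ) × X => V q.1.1 q.1.2 q.2) ∧ IsEvolutionOperator T G τ V := by
  obtain ⟨S, M, hM0, hM, hS, hST⟩ := hT.exists_extension hτ
  obtain ⟨V, D, hD0, hD, hV, hVeq⟩ := exists_evolution_family hM0 hM hS hC0 hC hG τ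
  have hint : ∀ s t, s ≤ t → ∀ x : X,
      IntervalIntegrable (fun σ => T (t - σ) (G σ (V σ s x))) volume s t := fun s t hst x => by
    refine hT.intervalIntegrable hst (Integrable.of_bound ?_ (C * (D * ‖x‖)) (ae_of_all _ fun σ =>
      (G σ).le_of_opNorm_le_of_le (hC σ) ((V σ s).le_of_opNorm_le (hD _ _) x)))
    exact hG.aestronglyMeasurable aestronglyMeasurable_id
      (hV.comp (by fun_prop : Continuous fun σ : ℝ => ((σ, s), x))).aestronglyMeasurable
  have heq : ∀ s t : ℝ, 0 ≤ s → s ≤ t → t ≤ τ → ∀ x : X,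
      V t s x = T (t - s) x + ∫ σ in s..t, T (t - σ) (G σ (V σ s x)) := fun s t hs hst ht x => by
    rw [hVeq s t hs hst ht x, hST (t - s) ⟨sub_nonneg.2 hst, by linarith⟩]
    congr 1
    refine intervalIntegral.integral_congr fun σ hσ => ?_
    rw [uIcc_of_le hst] at hσ
    simp only [hST (t - σ) ⟨sub_nonneg.2 hσ.2, by linarith [hσ.1]⟩]
  refine ⟨V, D, hD0, hD, hV, ?_, ?_, ?_, fun s t _ hst _ x => hint s t hst x, heq⟩
  · intro s hs
    ext x
    simpa [hT.zero] using heq s s hs.1 le_rfl hs.2 x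
  · intro s σ t hs hsσ hσt ht
    ext x
    have hσ0 : 0 ≤ σ := hs.trans hsσ
    -- By the semigroup law the equation can be restarted at `σ`. Both `V(t,s) x` and `V(t,σ) V(σ,s)
    -- x` then solve one integral equation on `[σ, τ]`, and Gronwall with `ρ = 0` identifies them.
    have hrestart : ∀ t ∈ Icc σ τ, V t s x =
        T (t - σ) (V σ s x) + ∫ r in σ..t, T (t - r) (G r (V r s x)) := by
      intro t ht
      have hst : s ≤ t := hsσ.trans ht.1
      have h1 : T (t - s) x = T (t - σ) (T (σ - s) x) := by
        rw [show t - s = (t - σ) + (σ - s) by ring,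
          hT.add _ _ (sub_nonneg.2 ht.1) (sub_nonneg.2 hsσ)]
        rfl
      have h2 : ∫ r in s..σ, T (t - r) (G r (V r s x)) =
          T (t - σ) (∫ r in s..σ, T (σ - r) (G r (V r s x))) := by
        rw [← (T (t - σ)).intervalIntegral_comp_comm (hint s σ hsσ x)]
        refine intervalIntegral.integral_congr fun r hr => ?_
        rw [uIcc_of_le hsσ] at hr
        rw [show t - r = (t - σ) + (σ - r) by ring,
          hT.add _ _ (sub_nonneg.2 ht.1) (sub_nonneg.2 hr.2)]
        rfl
      have hsub1 : uIcc s σ ⊆ uIcc s t := by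
        rw [uIcc_of_le hsσ, uIcc_of_le hst]; exact Icc_subset_Icc_right ht.1
      have hsub2 : uIcc σ t ⊆ uIcc s t := by
        rw [uIcc_of_le ht.1, uIcc_of_le hst]; exact Icc_subset_Icc_left hsσ
      rw [heq s t hs hst ht.2 x, ← intervalIntegral.integral_add_adjacent_intervals
        ((hint s t hst x).mono_set hsub1) ((hint s t hst x).mono_set hsub2), h1, h2,
        heq s σ hs hsσ (ht.1.trans ht.2) x, map_add, add_assoc]
    have hint' : ∀ t, σ ≤ t → IntervalIntegrable (fun r => T (t - r) (G r (V r s x))) volume σ t :=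
      fun t ht => (hint s t (hsσ.trans ht) x).mono_set (by
        rw [uIcc_of_le ht, uIcc_of_le (hsσ.trans ht)]; exact Icc_subset_Icc_left hsσ)
    have key := norm_le_of_eq_volterra_integral (a := σ) (b := τ) (K := M * C) (ρ := fun _ => 0)
      (d := fun t => V t s x - V t σ (V σ s x))
      (k := fun t r => T (t - r) (G r (V r s x)) - T (t - r) (G r (V r σ (V σ s x))))
      (by positivity)
      ((hV.comp (by fun_prop : Continuous fun t : ℝ => ((t, s), x))).sub
        (hV.comp (by fun_prop : Continuous fun t : ℝ => ((t, σ), V σ s x)))).continuousOn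
      (by simp) (fun _ => le_rfl)
      (fun t ht => by
        rw [intervalIntegral.integral_sub (hint' t ht.1) (hint σ t ht.1 _), hrestart t ht,
          heq σ t hσ0 ht.1 ht.2 (V σ s x)]
        abel)
      (fun t ht r hr => by
        rw [← map_sub, ← map_sub, add_zero, mul_assoc,
          ← hST (t - r) ⟨sub_nonneg.2 hr.2, by linarith [hr.1, ht.2]⟩]
        exact (S _).le_of_opNorm_le_of_le (hM _) ((G r).le_of_opNorm_le (hC r) _)) t ⟨hσt, ht⟩
    simpa [sub_eq_zero] using key
  · exact fun x => (hV.comp (by fun_prop : Continuous fun q : ℝ × ℝ => (q, x))).continuousOn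

theorem intervalIntegrable_family {V : ℝ → ℝ → X →L[ℝ] X} {D : ℝ}
    (hD : ∀ t s, ‖V t s‖ ≤ D) (hV : Continuous fun q : (ℝ × ℝ) × X => V q.1.1 q.1.2 q.2)
    {f : ℝ → X} {τ : ℝ} (hf : Integrable f (timeMeasure τ)) (r : ℝ) {t : ℝ} (ht : t ∈ Icc 0 τ) :
    IntervalIntegrable (fun s => V r s (f s)) volume 0 t := by
  rw [intervalIntegrable_iff_integrableOn_Ioc_of_le ht.1]
  have h1 : Integrable (fun s => V r s (f s)) (timeMeasure τ) := (hf.norm.const_mul D).mono'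
    (hV.comp_aestronglyMeasurable
      ((by fun_prop : Continuous fun s : ℝ => (r, s)).aestronglyMeasurable.prodMk hf.1))
    (ae_of_all _ fun s => (V r s).le_of_opNorm_le (hD _ _) _)
  exact IntegrableOn.mono_set h1 (Ioc_subset_Ioc_right ht.2)

theorem continuousOn_integral_family {V : ℝ → ℝ → X →L[ℝ] X} {D : ℝ}
    (hD : ∀ t s, ‖V t s‖ ≤ D) (hV : Continuous fun q : (ℝ × ℝ) × X => V q.1.1 q.1.2 q.2)
    {f : ℝ → X} {τ : ℝ} (hf : Integrable f (timeMeasure τ)) :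
    ContinuousOn (fun t => ∫ s in (0 : ℝ)..t, V t s (f s)) (Icc 0 τ) := by
  have := continuous_setIntegral_Ioc (μ := timeMeasure τ) (a := fun _ : ℝ => 0) (b := fun t => t)
    continuous_const continuous_id (h := fun t s => V t s (f s)) (g := fun s => D * ‖f s‖)
    (fun t => hV.comp_aestronglyMeasurable
      ((by fun_prop : Continuous fun s : ℝ => (t, s)).aestronglyMeasurable.prodMk hf.1))
    (fun t s => (V t s).le_of_opNorm_le (hD _ _) _) (hf.norm.const_mul D)
    (fun s => hV.comp (by fun_prop : Continuous fun t : ℝ => ((t, s), f s)))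
  exact this.continuousOn.congr fun t ht => (setIntegral_timeMeasure le_rfl ht.1 ht.2).symm

/-- Variation of constants for the perturbed equation. -/
theorem IsEvolutionOperator.isMildSolution [CompleteSpace X] {T : ℝ → X →L[ℝ] X}
    (hT : IsStronglyContinuousSemigroup T) {G : ℝ → X →L[ℝ] X} {C : ℝ}
    (hC : ∀ t, ‖G t‖ ≤ C) (hG : IsLimitOfContinuous G) {τ : ℝ} (hτ : 0 ≤ τ)
    {V : ℝ → ℝ → X →L[ℝ] X} {D : ℝ} (hD : ∀ t s, ‖V t s‖ ≤ D)
    (hV : Continuous fun q : (ℝ × ℝ) × X => V q.1.1 q.1.2 q.2) (hVop : IsEvolutionOperator T G τ V)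
    {f : ℝ → X} (hf : Integrable f (timeMeasure τ)) :
    IsMildSolution T (fun t z => G t z) f 0 τ (fun t => ∫ s in (0 : ℝ)..t, V t s (f s)) := by
  obtain ⟨S, M, hM0, hM, hS, hST⟩ := hT.exists_extension hτ
  set y : ℝ → X := fun t => ∫ s in (0 : ℝ)..t, V t s (f s) with hy
  have hyc : ContinuousOn y (Icc 0 τ) := continuousOn_integral_family hD hV hf
  have hforce : ∀ t ∈ Icc 0 τ, IntervalIntegrable (fun s => T (t - s) (f s)) volume 0 t :=
    fun t ht => hT.intervalIntegrable ht.1 (IntegrableOn.mono_set hf (Ioc_subset_Ioc_right ht.2))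
  refine ⟨hyc, fun t ht => ?_, hforce, fun t ht => ?_⟩
  · have hyt : IntegrableOn y (Ioc 0 t) := (hyc.mono
      (Icc_subset_Icc_right ht.2)).integrableOn_Icc.mono_set Ioc_subset_Icc_self
    refine hT.intervalIntegrable ht.1 ((hyt.norm.const_mul C).mono'
      (hG.aestronglyMeasurable aestronglyMeasurable_id hyt.1)
      (ae_of_all _ fun s => (G s).le_of_opNorm_le (hC s) _))
  · set μ : Measure ℝ := volume.restrict (Ioc 0 t) with hμ
    have hfμ : Integrable f μ := IntegrableOn.mono_set hf (Ioc_subset_Ioc_right ht.2)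
    set H : ℝ → ℝ → X := fun s r => S (t - s) (G s (V s r (f r))) with hH
    -- Fubini on the triangle `r ≤ s`. Integrating `H` over `r` first gives the perturbation term of
    -- the mild equation; over `s` first, the evolution equation collapses it to `V(t,r) f(r) -
    -- T(t-r) f(r)`.
    set Δ : Set (ℝ × ℝ) := {q | q.2 ≤ q.1} with hΔ
    have hΔm : MeasurableSet Δ := measurableSet_le measurable_snd measurable_fst
    have hHint : Integrable (fun q : ℝ × ℝ => H q.1 q.2) (μ.prod μ) := by
      have hm1 : AEStronglyMeasurable (fun q : ℝ × ℝ => f q.2) (μ.prod μ) := hfμ.1.comp_snd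
      have hm2 : AEStronglyMeasurable (fun q : ℝ × ℝ => V q.1 q.2 (f q.2)) (μ.prod μ) :=
        hV.comp_aestronglyMeasurable (aestronglyMeasurable_id.prodMk hm1)
      have hm3 := hG.aestronglyMeasurable (φ := fun q : ℝ × ℝ => q.1)
        continuous_fst.aestronglyMeasurable hm2
      refine ((hfμ.norm.comp_snd μ).const_mul (M * (C * D))).mono'
        (hS.comp_aestronglyMeasurable ((by fun_prop : Continuous fun q : ℝ × ℝ =>
          t - q.1).aestronglyMeasurable.prodMk hm3)) (ae_of_all _ fun q => ?_)
      calc ‖H q.1 q.2‖ ≤ M * (C * (D * ‖f q.2‖)) := (S _).le_of_opNorm_le_of_le (hM _)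
            ((G _).le_of_opNorm_le_of_le (hC _) ((V _ _).le_of_opNorm_le (hD _ _) _))
        _ = M * (C * D) * ‖f q.2‖ := by ring
    have hswap := integral_integral_swap (f := fun s r => Δ.indicator (fun q => H q.1 q.2) (s, r))
      (hHint.indicator hΔm)
    have hleft : ∫ s in (0 : ℝ)..t, T (t - s) (G s (y s)) =
        ∫ s, ∫ r, Δ.indicator (fun q => H q.1 q.2) (s, r) ∂μ ∂μ := by
      rw [intervalIntegral.integral_of_le ht.1]
      refine setIntegral_congr_fun measurableSet_Ioc fun s hs => ?_
      have hsτ : s ∈ Icc 0 τ := ⟨hs.1.le, hs.2.trans ht.2⟩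
      have h1 : (fun r => Δ.indicator (fun q => H q.1 q.2) (s, r)) = (Iic s).indicator (H s) := by
        ext r; simp [indicator, hΔ]
      simp only [h1]
      rw [integral_indicator measurableSet_Iic, hμ, Measure.restrict_restrict measurableSet_Iic,
        show Iic s ∩ Ioc 0 t = Ioc 0 s by
          ext r; exact ⟨fun h => ⟨h.2.1, h.1⟩, fun h => ⟨h.2, h.1, h.2.trans hs.2⟩⟩,
        ← intervalIntegral.integral_of_le hs.1.le,
        ← hST (t - s) ⟨sub_nonneg.2 hs.2, by linarith [hs.1, ht.2]⟩]
      exact (((S (t - s)).comp (G s)).intervalIntegral_comp_comm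
        (intervalIntegrable_family hD hV hf s hsτ)).symm
    have hright : ∫ r, ∫ s, Δ.indicator (fun q => H q.1 q.2) (s, r) ∂μ ∂μ =
        ∫ r in (0 : ℝ)..t, (V t r (f r) - T (t - r) (f r)) := by
      rw [intervalIntegral.integral_of_le ht.1]
      refine setIntegral_congr_fun measurableSet_Ioc fun r hr => ?_
      have h1 : (fun s => Δ.indicator (fun q => H q.1 q.2) (s, r)) =
          (Ici r).indicator (fun s => H s r) := by
        ext s; simp [indicator, hΔ]
      simp only [h1]
      rw [integral_indicator measurableSet_Ici, hμ, Measure.restrict_restrict measurableSet_Ici,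
        show Ici r ∩ Ioc 0 t = Icc r t by
          ext s; exact ⟨fun h => ⟨h.1, h.2.2⟩, fun h => ⟨h.1, hr.1.trans_le h.1, h.2⟩⟩,
        integral_Icc_eq_integral_Ioc, ← intervalIntegral.integral_of_le hr.2,
        hVop.eq r t hr.1.le hr.2 ht.2, add_sub_cancel_left]
      refine intervalIntegral.integral_congr fun s hs => ?_
      rw [uIcc_of_le hr.2] at hs
      simp only [hH, hST (t - s) ⟨sub_nonneg.2 hs.2, by linarith [hs.1, hr.1, ht.2]⟩]
    rw [hleft, hswap, hright, intervalIntegral.integral_sub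
      (intervalIntegrable_family hD hV hf t ht) (hforce t ht), map_zero, zero_add, sub_add_cancel]

end EvolutionOperators

/-! ### Local existence by contraction -/

section LocalExistence

theorem continuous_of_lipschitz_on_balls {X : Type*} [NormedAddCommGroup X] {F : X → X}
    (hF : ∀ δ : ℝ, 0 < δ → ∃ L : ℝ, 0 < L ∧ ∀ x₁ x₂ : X, ‖x₁‖ ≤ δ → ‖x₂‖ ≤ δ →
      ‖F x₂ - F x₁‖ ≤ L * ‖x₂ - x₁‖) : Continuous F := by
  refine continuous_iff_continuousAt.2 fun x => ?_
  obtain ⟨L, hL0, hL⟩ := hF (‖x‖ + 1) (by positivity)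
  refine continuousAt_of_locally_lipschitz one_pos L fun z hz => ?_
  rw [dist_eq_norm] at hz ⊢
  rw [dist_eq_norm]
  refine hL _ _ (by linarith) ?_
  have := norm_le_norm_add_norm_sub' z x
  linarith

variable {X : Type*} [NormedAddCommGroup X] [NormedSpace ℝ X]

/-- Banach's fixed point theorem on the closed `δ`-ball of `C([0,τ];X)`: `hsmall` makes the ball
invariant, using `F 0 = 0`, and `hcontr` gives the contraction constant `1/2`. -/
theorem exists_mildSolution_of_small [CompleteSpace X] {T : ℝ → X →L[ℝ] X}
    (hT : IsStronglyContinuousSemigroup T) {F : X → X} (hFc : Continuous F) (hF0 : F 0 = 0)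
    {δ L M τ : ℝ} (hτ : 0 ≤ τ) (hδ : 0 ≤ δ) (hL0 : 0 ≤ L)
    (hL : ∀ x₁ x₂ : X, ‖x₁‖ ≤ δ → ‖x₂‖ ≤ δ → ‖F x₂ - F x₁‖ ≤ L * ‖x₂ - x₁‖)
    (hM0 : 0 ≤ M) (hM : ∀ t ∈ Icc 0 τ, ‖T t‖ ≤ M) {f : ℝ → X}
    (hf : Integrable f (timeMeasure τ)) {x₀ : X}
    (hsmall : M * ‖x₀‖ + M * (L * δ) * τ + M * (∫ s in (0 : ℝ)..τ, ‖f s‖) ≤ δ)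
    (hcontr : M * L * τ ≤ 1 / 2) :
    ∃ x : ℝ → X, IsMildSolution T (fun _ y => F y) f x₀ τ x := by
  obtain ⟨S, M', -, hM', hS, hST⟩ := hT.exists_extension hτ
  have hk : Continuous fun q : (ℝ × ℝ) × X => S (q.1.1 - q.1.2) q.2 :=
    hS.comp (by fun_prop : Continuous fun q : (ℝ × ℝ) × X => (q.1.1 - q.1.2, q.2))
  have hkT : ∀ t ∈ Icc 0 τ, ∀ g : ℝ → X,
      ∫ s in (0 : ℝ)..t, S (t - s) (g s) = ∫ s in (0 : ℝ)..t, T (t - s) (g s) := fun t ht g => by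
    refine intervalIntegral.integral_congr fun s hs => ?_
    rw [uIcc_of_le ht.1] at hs
    simp only [hST (t - s) ⟨sub_nonneg.2 hs.2, by linarith [hs.1, ht.2]⟩]
  have hconv : ∀ g : ℝ → X, Integrable g (timeMeasure τ) →
      ContinuousOn (fun t => ∫ s in (0 : ℝ)..t, T (t - s) (g s)) (Icc 0 τ) := fun g hg =>
    (continuousOn_integral_family (V := fun t s => S (t - s)) (fun t s => hM' _) hk hg).congr
      fun t ht => (hkT t ht g).symm
  have hTint : ∀ g : ℝ → X, Integrable g (timeMeasure τ) → ∀ t ∈ Icc 0 τ,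
      IntervalIntegrable (fun s => T (t - s) (g s)) volume 0 t := fun g hg t ht =>
    hT.intervalIntegrable ht.1 (IntegrableOn.mono_set hg (Ioc_subset_Ioc_right ht.2))
  let ext : C(Icc 0 τ, X) → ℝ → X := fun x => IccExtend hτ x
  have hext : ∀ x, Continuous (ext x) := fun x => x.continuous.Icc_extend'
  have hFext : ∀ x, Integrable (fun s => F (ext x s)) (timeMeasure τ) := fun x =>
    ((hFc.comp (hext x)).integrableOn_Icc (a := 0) (b := τ)).mono_set Ioc_subset_Icc_self
  let Ψ : C(Icc 0 τ, X) → ℝ → X := fun x t => T t x₀ +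
    (∫ s in (0 : ℝ)..t, T (t - s) (F (ext x s))) + ∫ s in (0 : ℝ)..t, T (t - s) (f s)
  have hΨ : ∀ x, ContinuousOn (Ψ x) (Icc 0 τ) := fun x =>
    (((hT.continuousOn x₀).mono fun t ht => ht.1).add (hconv _ (hFext x))).add (hconv f hf)
  let Φ : C(Icc 0 τ, X) → C(Icc 0 τ, X) := fun x => ⟨_, (hΨ x).domRestrict⟩
  have hΦ : ∀ x t, Φ x t = Ψ x t := fun x t => rfl
  have hTs : ∀ t ∈ Icc 0 τ, ∀ s ∈ Ioc 0 t, ‖T (t - s)‖ ≤ M := fun t ht s hs =>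
    hM _ ⟨sub_nonneg.2 hs.2, by linarith [hs.1, ht.2]⟩
  have hextn : ∀ x ∈ Metric.closedBall (0 : C(Icc 0 τ, X)) δ, ∀ s, ‖ext x s‖ ≤ δ :=
    fun x hx s => (x.norm_coe_le_norm _).trans (by simpa using hx)
  have hmaps : MapsTo Φ (Metric.closedBall 0 δ) (Metric.closedBall 0 δ) := by
    intro x hx
    rw [mem_closedBall_zero_iff, ContinuousMap.norm_le _ hδ]
    rintro ⟨t, ht⟩
    rw [hΦ]
    refine (norm_add₃_le).trans (le_trans ?_ hsmall)
    gcongr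
    · exact (T t).le_of_opNorm_le (hM t ht) _
    · calc _ ≤ M * (L * δ) * |t - 0| := by
            refine intervalIntegral.norm_integral_le_of_norm_le_const fun s hs => ?_
            rw [uIoc_of_le ht.1] at hs
            refine (T _).le_of_opNorm_le_of_le (hTs t ht s hs) ?_
            have := hL 0 (ext x s) (by simpa using hδ) (hextn x hx s)
            rw [hF0, sub_zero, sub_zero] at this
            exact this.trans (mul_le_mul_of_nonneg_left (hextn x hx s) hL0)
        _ ≤ M * (L * δ) * τ := by
            rw [sub_zero, abs_of_nonneg ht.1]
            exact mul_le_mul_of_nonneg_left ht.2 (by positivity)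
    · have hfi : IntervalIntegrable f volume 0 τ :=
        (intervalIntegrable_iff_integrableOn_Ioc_of_le hτ).2 hf
      calc _ ≤ ∫ s in (0 : ℝ)..t, M * ‖f s‖ :=
            intervalIntegral.norm_integral_le_of_norm_le ht.1
              (ae_of_all _ fun s hs => (T _).le_of_opNorm_le (hTs t ht s hs) _)
              ((hfi.norm.const_mul M).mono_set (by
                rw [uIcc_of_le ht.1, uIcc_of_le hτ]; exact Icc_subset_Icc_right ht.2))
        _ ≤ ∫ s in (0 : ℝ)..τ, M * ‖f s‖ :=
            intervalIntegral.integral_mono_interval le_rfl ht.1 ht.2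
              (ae_of_all _ fun s => by positivity) (hfi.norm.const_mul M)
        _ = _ := intervalIntegral.integral_const_mul _ _
  have hlip : ContractingWith (1 / 2 : NNReal) (hmaps.restrict Φ _ _) := by
    refine ⟨by norm_num, LipschitzWith.of_dist_le_mul ?_⟩
    rintro ⟨x, hx⟩ ⟨z, hz⟩
    change dist (Φ x) (Φ z) ≤ _ * dist x z
    rw [ContinuousMap.dist_le (by positivity)]
    rintro ⟨t, ht⟩
    rw [hΦ, hΦ, dist_eq_norm]
    have hdiff : Ψ x t - Ψ z t =
        ∫ s in (0 : ℝ)..t, T (t - s) (F (ext x s) - F (ext z s)) := by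
      simp only [map_sub]
      rw [intervalIntegral.integral_sub (hTint _ (hFext x) t ht) (hTint _ (hFext z) t ht)]
      simp only [Ψ]
      abel
    rw [hdiff]
    calc _ ≤ M * (L * dist x z) * |t - 0| := by
          refine intervalIntegral.norm_integral_le_of_norm_le_const fun s hs => ?_
          rw [uIoc_of_le ht.1] at hs
          refine (T _).le_of_opNorm_le_of_le (hTs t ht s hs)
            ((hL _ _ (hextn z hz s) (hextn x hx s)).trans (mul_le_mul_of_nonneg_left ?_ hL0))
          rw [← dist_eq_norm]
          exact ContinuousMap.dist_apply_le_dist _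
      _ ≤ M * (L * dist x z) * τ := by
          rw [sub_zero, abs_of_nonneg ht.1]
          exact mul_le_mul_of_nonneg_left ht.2 (by positivity)
      _ = M * L * τ * dist x z := by ring
      _ ≤ 1 / 2 * dist x z := mul_le_mul_of_nonneg_right hcontr dist_nonneg
      _ = _ := by simp
  obtain ⟨x, hx, hfix, -⟩ := hlip.exists_fixedPoint' Metric.isClosed_closedBall.isComplete hmaps
    (Metric.mem_closedBall_self hδ) (edist_ne_top _ _)
  have hxt : ∀ t ∈ Icc 0 τ, ext x t = Ψ x t := fun t ht => by
    simp only [ext]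
    rw [IccExtend_of_mem hτ x ht]
    exact (DFunLike.congr_fun hfix ⟨t, ht⟩).symm
  exact ⟨ext x, (hext x).continuousOn, hTint _ (hFext x), hTint _ hf, hxt⟩

end LocalExistence

/-! ### Convergence of difference quotients of trajectories -/

section Linearization

variable {X : Type*} [NormedAddCommGroup X] [NormedSpace ℝ X]

/-- Difference quotients of `F` with step `1/(n+1)` are jointly continuous in time and direction,
and converge pointwise by Gâteaux differentiability. -/
theorem isLimitOfContinuous_gateaux {F : X → X} (hFc : Continuous F) {F' : X → X →L[ℝ] X}
    (hF' : ∀ x : X, HasGateauxDerivAt F (F' x) x) {x : ℝ → X} (hx : Continuous x) :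
    IsLimitOfContinuous fun s => F' (x s) := by
  refine ⟨fun n q => (1 / ((n : ℝ) + 1))⁻¹ • (F (x q.1 + (1 / ((n : ℝ) + 1)) • q.2) - F (x q.1)),
    fun n => by fun_prop, fun s h => ?_⟩
  have h1 := (hF' (x s) h).tendsto_slope_zero
  have h2 : Tendsto (fun n : ℕ => 1 / ((n : ℝ) + 1)) atTop (𝓝[≠] 0) :=
    tendsto_nhdsWithin_iff.2 ⟨tendsto_one_div_add_atTop_nhds_zero_nat,
      Eventually.of_forall fun n => by simp only [mem_compl_iff, mem_singleton_iff]; positivity⟩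
  exact h1.comp h2

/-- Two uses of Gronwall: first to confine the perturbed trajectories to a ball where one Lipschitz
constant holds, then to bound the error of the difference quotient by the integral of the residual
`ρ`. -/
theorem eventually_norm_slope_sub_le [CompleteSpace X] {T : ℝ → X →L[ℝ] X}
    (hT : IsStronglyContinuousSemigroup T) {F : X → X}
    (hF : ∀ δ : ℝ, 0 < δ → ∃ L : ℝ, 0 < L ∧ ∀ x₁ x₂ : X, ‖x₁‖ ≤ δ → ‖x₂‖ ≤ δ →
      ‖F x₂ - F x₁‖ ≤ L * ‖x₂ - x₁‖)
    {F' : X → X →L[ℝ] X} (hF' : ∀ x : X, HasGateauxDerivAt F (F' x) x)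
    (hF'bdd : ∀ s : Set X, Bornology.IsBounded s → Bornology.IsBounded (F' '' s))
    {τ : ℝ} (hτ : 0 ≤ τ) {x₀ : X} {f g : ℝ → X} {xo y : ℝ → X} {fε xε : ℝ → ℝ → X}
    (hg : Integrable g (timeMeasure τ))
    (hxo : IsMildSolution T (fun _ z => F z) f x₀ τ xo)
    (hy : IsMildSolution T (fun t z => F' (xo t) z) g 0 τ y)
    (hxε : ∀ᶠ ε in 𝓝[≠] 0, IsMildSolution T (fun _ z => F z) (fε ε) x₀ τ (xε ε))
    (hfε : ∀ ε, fε ε =ᵐ[timeMeasure τ] fun s => f s + ε • g s) {η : ℝ} (hη : 0 < η) :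
    ∀ᶠ ε in 𝓝[≠] 0, ∀ t ∈ Icc 0 τ, ‖ε⁻¹ • (xε ε t - xo t) - y t‖ ≤ η := by
  have hFc := continuous_of_lipschitz_on_balls hF
  obtain ⟨M, hM0, hM⟩ := hT.exists_norm_le hτ
  obtain ⟨r₀, hr₀⟩ := isCompact_Icc.exists_bound_of_continuousOn hxo.continuousOn
  obtain ⟨r₁, hr₁⟩ := isCompact_Icc.exists_bound_of_continuousOn hy.continuousOn
  have h0τ : (0 : ℝ) ∈ Icc 0 τ := ⟨le_rfl, hτ⟩
  have hr₀0 : 0 ≤ r₀ := (norm_nonneg _).trans (hr₀ 0 h0τ)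
  have hr₁0 : 0 ≤ r₁ := (norm_nonneg _).trans (hr₁ 0 h0τ)
  -- This radius contains `xo`, the perturbed trajectories within distance `1` of it, and `xo + εy`
  -- for `|ε| < 1`.
  obtain ⟨L, hL0, hL⟩ := hF (r₀ + r₁ + 1) (by positivity)
  obtain ⟨C, hC⟩ := (hF'bdd _ (Metric.isBounded_closedBall (x := (0 : X)) (r := r₀))).exists_norm_le
  have hgi : IntervalIntegrable g volume 0 τ :=
    (intervalIntegrable_iff_integrableOn_Ioc_of_le hτ).2 hg
  have hff : ∀ ε, ∀ᵐ s, s ∈ Ioc 0 τ → fε ε s - f s = ε • g s := fun ε =>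
    (ae_restrict_iff' measurableSet_Ioc).1 ((hfε ε).mono fun s hs => by
      rw [hs]; exact add_sub_cancel_left _ _)
  -- the perturbed trajectories stay close to the reference trajectory
  have hclose : ∀ᶠ ε in 𝓝[≠] (0 : ℝ), ∀ t ∈ Icc 0 τ, ‖xε ε t - xo t‖ < 1 := by
    have hlim : Tendsto (fun ε : ℝ => |ε| * ((∫ s in (0 : ℝ)..τ, M * ‖g s‖) *
        Real.exp (M * L * τ))) (𝓝[≠] 0) (𝓝 0) := by
      have : Continuous fun ε : ℝ => |ε| * ((∫ s in (0 : ℝ)..τ, M * ‖g s‖) *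
        Real.exp (M * L * τ)) := by fun_prop
      simpa using (this.tendsto 0).mono_left nhdsWithin_le_nhds
    filter_upwards [hxε, hlim.eventually_lt_const one_pos] with ε hε hε1
    -- A bootstrap: `L` is usable only while the distance is at most `1`, and up to such a time
    -- Gronwall bounds the distance by a multiple of `|ε|`, which is below `1`.
    refine lt_one_of_continuation (φ := fun t => ‖xε ε t - xo t‖)
      (hε.continuousOn.sub hxo.continuousOn).norm (fun t ht hbefore hat => ?_) ?_
    · have hle : ∀ s ∈ Icc 0 t, ‖xε ε s - xo s‖ ≤ 1 := fun s hs => by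
        rcases hs.2.eq_or_lt with rfl | h
        · exact hat
        · exact (hbefore s ⟨hs.1, h⟩).le
      have hae : ∀ᵐ s, s ∈ Ioc 0 t → fε ε s - f s = ε • g s := (hff ε).mono fun s hs hst =>
        hs ⟨hst.1, hst.2.trans ht.2⟩
      have hgt : IntervalIntegrable g volume 0 t := hgi.mono_set (by
        rw [uIcc_of_le ht.1, uIcc_of_le hτ]; exact Icc_subset_Icc_right ht.2)
      have hfi : IntervalIntegrable (fun s => fε ε s - f s) volume 0 t :=
        (hgt.smul ε).congr_ae (by
          rw [EventuallyEq, ae_restrict_iff' measurableSet_uIoc, uIoc_of_le ht.1]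
          exact hae.mono fun s hs hst => (hs hst).symm)
      have key := (hε.mono ht.2).norm_sub_le (hxo.mono ht.2) hM0
        (fun s hs => hM s ⟨hs.1, hs.2.trans ht.2⟩) hL0.le (fun s hs => ?_) hfi t ⟨ht.1, le_rfl⟩
      · refine key.trans_lt (lt_of_le_of_lt ?_ hε1)
        rw [← mul_assoc]
        refine mul_le_mul ?_ ?_ (Real.exp_pos _).le (mul_nonneg (abs_nonneg _)
          (intervalIntegral.integral_nonneg hτ fun s _ => by positivity))
        · calc _ = ∫ s in (0 : ℝ)..t, |ε| * (M * ‖g s‖) := by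
                refine intervalIntegral.integral_congr_ae (hae.mono fun s hs hst => ?_)
                rw [uIoc_of_le ht.1] at hst
                rw [hs hst, norm_smul, Real.norm_eq_abs]
                ring
            _ ≤ ∫ s in (0 : ℝ)..τ, |ε| * (M * ‖g s‖) :=
                intervalIntegral.integral_mono_interval le_rfl ht.1 ht.2
                  (ae_of_all _ fun s => by positivity) ((hgi.norm.const_mul M).const_mul _)
            _ = _ := intervalIntegral.integral_const_mul _ _
        · exact Real.exp_le_exp.2 (mul_le_mul_of_nonneg_left ht.2 (by positivity))
      · have h1 := hr₀ s ⟨hs.1, hs.2.trans ht.2⟩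
        have h2 := norm_le_norm_add_norm_sub' (xε ε s) (xo s)
        exact hL _ _ (by linarith) (by linarith [hle s hs])
    · have h1 := hε.eq 0 h0τ
      have h2 := hxo.eq 0 h0τ
      simp only [intervalIntegral.integral_same, add_zero] at h1 h2
      simp [h1, h2]
  -- continuous extensions of the reference trajectory and of the linearized solution
  set zo : ℝ → X := IccExtend hτ ((Icc 0 τ).domRestrict xo) with hzo
  set w : ℝ → X := IccExtend hτ ((Icc 0 τ).domRestrict y) with hw
  have hzoc : Continuous zo := continuous_IccExtend_iff.2 hxo.continuousOn.domRestrict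
  have hwc : Continuous w := continuous_IccExtend_iff.2 hy.continuousOn.domRestrict
  have hzoeq : ∀ s ∈ Icc 0 τ, zo s = xo s := fun s hs => IccExtend_of_mem hτ _ hs
  have hweq : ∀ s ∈ Icc 0 τ, w s = y s := fun s hs => IccExtend_of_mem hτ _ hs
  have hzob : ∀ s, ‖zo s‖ ≤ r₀ := fun s => hr₀ _ (projIcc 0 τ hτ s).2
  have hwb : ∀ s, ‖w s‖ ≤ r₁ := fun s => hr₁ _ (projIcc 0 τ hτ s).2
  set ρ : ℝ → ℝ → ℝ := fun ε s => ‖ε⁻¹ • (F (zo s + ε • w s) - F (zo s)) - F' (zo s) (w s)‖ with hρ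
  have hρm : ∀ ε, AEStronglyMeasurable (ρ ε) (timeMeasure τ) := fun ε =>
    ((by fun_prop : Continuous fun s => ε⁻¹ • (F (zo s + ε • w s) - F (zo s))
      ).aestronglyMeasurable.sub ((isLimitOfContinuous_gateaux hFc hF' hzoc).aestronglyMeasurable
        aestronglyMeasurable_id hwc.aestronglyMeasurable)).norm
  have hsmall : ∀ᶠ ε in 𝓝[≠] (0 : ℝ), ε ≠ 0 ∧ |ε| < 1 := by
    refine (eventually_mem_nhdsWithin.mono fun ε hε => hε).and ?_
    have : Tendsto (fun ε : ℝ => |ε|) (𝓝[≠] 0) (𝓝 0) := by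
      simpa using (continuous_abs.tendsto (0 : ℝ)).mono_left nhdsWithin_le_nhds
    exact this.eventually_lt_const one_pos
  have hball : ∀ ε : ℝ, |ε| < 1 → ∀ s, ‖zo s + ε • w s‖ ≤ r₀ + r₁ + 1 := fun ε hε s => by
    have h1 : ‖ε • w s‖ ≤ r₁ := by
      rw [norm_smul, Real.norm_eq_abs]
      exact (mul_le_of_le_one_left (norm_nonneg _) hε.le).trans (hwb s)
    linarith [norm_add_le (zo s) (ε • w s), hzob s]
  have hρb : ∀ ε : ℝ, ε ≠ 0 → |ε| < 1 → ∀ s, ‖ρ ε s‖ ≤ L * r₁ + C * r₁ := fun ε hε0 hε s => by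
    have hεp : 0 < |ε| := abs_pos.2 hε0
    rw [hρ, norm_norm]
    refine (norm_sub_le _ _).trans (add_le_add ?_
      ((F' _).le_of_opNorm_le_of_le (hC _ ⟨_, by simpa using hzob s, rfl⟩) (hwb s)))
    have h1 := hL (zo s) (zo s + ε • w s) (by linarith [hzob s]) (hball ε hε s)
    rw [add_sub_cancel_left, norm_smul, Real.norm_eq_abs] at h1
    rw [norm_smul, norm_inv, Real.norm_eq_abs]
    calc |ε|⁻¹ * _ ≤ |ε|⁻¹ * (L * (|ε| * ‖w s‖)) := by gcongr
      _ = L * ‖w s‖ := by field_simp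
      _ ≤ L * r₁ := by gcongr; exact hwb s
  have hρlim : Tendsto (fun ε => (∫ s in (0 : ℝ)..τ, M * ρ ε s) * Real.exp (M * L * τ))
      (𝓝[≠] 0) (𝓝 0) := by
    have h1 : Tendsto (fun ε => ∫ s, ρ ε s ∂(timeMeasure τ)) (𝓝[≠] 0)
        (𝓝 (∫ s, (0 : ℝ) ∂(timeMeasure τ))) := by
      -- Pointwise convergence is Gâteaux differentiability at `zo s` in the fixed direction `w s`;
      -- the bound comes from the Lipschitz constant and the boundedness of `F'` on the ball.
      refine tendsto_integral_filter_of_dominated_convergence (fun _ => L * r₁ + C * r₁)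
        (Eventually.of_forall hρm)
        (hsmall.mono fun ε hε => ae_of_all _ (hρb ε hε.1 hε.2)) (integrable_const _)
        (ae_of_all _ fun s => ?_)
      have := ((hF' (zo s) (w s)).tendsto_slope_zero.sub_const (F' (zo s) (w s))).norm
      simpa using this
    rw [integral_zero] at h1
    have h2 := (h1.const_mul M).mul_const (Real.exp (M * L * τ))
    simp only [mul_zero, zero_mul] at h2
    refine h2.congr fun ε => ?_
    rw [intervalIntegral.integral_const_mul, intervalIntegral.integral_of_le hτ]
  filter_upwards [hxε, hclose, hsmall, hρlim.eventually_lt_const hη] with ε hε hεc hε1 hεη t ht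
  have hεp : 0 < |ε| := abs_pos.2 hε1.1
  have hρi : IntervalIntegrable (fun s => M * ρ ε s) volume 0 τ := by
    refine IntervalIntegrable.const_mul ?_ M
    exact (intervalIntegrable_iff_integrableOn_Ioc_of_le hτ).2
      (Integrable.of_bound (hρm ε) _ (ae_of_all _ (hρb ε hε1.1 hε1.2)))
  have key := norm_le_of_eq_volterra_integral (a := 0) (b := τ) (K := M * L)
    (ρ := fun s => M * ρ ε s) (d := fun t => ε⁻¹ • (xε ε t - xo t) - y t)
    (k := fun t s => T (t - s) (ε⁻¹ • (F (xε ε s) - F (xo s)) - F' (xo s) (y s)))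
    (by positivity) (((hε.continuousOn.sub hxo.continuousOn).const_smul ε⁻¹).sub hy.continuousOn)
    hρi (fun s => mul_nonneg hM0 (norm_nonneg _)) (fun t ht => ?_) (fun t ht s hs => ?_) t ht
  · refine key.trans (le_trans ?_ hεη.le)
    rw [sub_zero]
    have : 0 ≤ ∫ s in (0 : ℝ)..τ, M * ρ ε s :=
      intervalIntegral.integral_nonneg hτ fun s _ => mul_nonneg hM0 (norm_nonneg _)
    gcongr
    exact ht.2
  · have h1 := hε.integrable_perturbation t ht
    have h2 := hxo.integrable_perturbation t ht
    have h3 := hy.integrable_perturbation t ht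
    have hforce : (∫ s in (0 : ℝ)..t, T (t - s) (fε ε s)) =
        (∫ s in (0 : ℝ)..t, T (t - s) (f s)) + ε • ∫ s in (0 : ℝ)..t, T (t - s) (g s) := by
      have h4 : IntervalIntegrable (fun s => ε • T (t - s) (g s)) volume 0 t :=
        (hy.integrable_forcing t ht).smul ε
      rw [← intervalIntegral.integral_smul, ← intervalIntegral.integral_add
        (hxo.integrable_forcing t ht) h4]
      refine intervalIntegral.integral_congr_ae ((hff ε).mono fun s hs hst => ?_)
      rw [uIoc_of_le ht.1] at hst
      rw [← sub_add_cancel (fε ε s) (f s), hs ⟨hst.1, hst.2.trans ht.2⟩]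
      simp [add_comm]
    have h12 : IntervalIntegrable (fun s => ε⁻¹ • (T (t - s) (F (xε ε s)) - T (t - s) (F (xo s))))
      volume 0 t := (h1.sub h2).smul ε⁻¹
    simp only [map_sub, map_smul]
    rw [intervalIntegral.integral_sub h12 h3, intervalIntegral.integral_smul,
      intervalIntegral.integral_sub h1 h2, hε.eq t ht, hxo.eq t ht, hy.eq t ht, hforce, map_zero,
      zero_add]
    -- The forcing increment `ε g`, divided by `ε`, cancels the forcing of the linearized equation.
    have : ∀ a b c d e k : X, ε⁻¹ • (a + b + (c + ε • d) - (a + e + c)) - (k + d) =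
        ε⁻¹ • (b - e) - k := fun a b c d e k => by
      rw [show a + b + (c + ε • d) - (a + e + c) = (b - e) + ε • d by abel, smul_add,
        inv_smul_smul₀ hε1.1]
      abel
    exact this _ _ _ _ _ _
  · have hsτ : s ∈ Icc 0 τ := ⟨hs.1.le, hs.2.trans ht.2⟩
    have hTs := hM (t - s) ⟨sub_nonneg.2 hs.2, by linarith [hs.1, ht.2]⟩
    have hb1 := hball ε hε1.2 s
    have hx1 : ‖xε ε s‖ ≤ r₀ + r₁ + 1 := by
      have h1 := hr₀ s hsτ
      have h2 := norm_le_norm_add_norm_sub' (xε ε s) (xo s)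
      linarith [hεc s hsτ]
    have hlip := hL _ _ hb1 hx1
    simp only [hρ]
    rw [hzoeq s hsτ, hweq s hsτ] at hlip ⊢
    rw [mul_assoc, ← mul_add]
    refine (T _).le_of_opNorm_le_of_le hTs ?_
    -- Inserting `F(xo + εy)`: the first term is at most `L‖d‖`, since `xε - (xo + εy) = ε d`, and
    -- the second is the residual.
    have hsplit : ε⁻¹ • (F (xε ε s) - F (xo s)) - F' (xo s) (y s) =
        ε⁻¹ • (F (xε ε s) - F (xo s + ε • y s)) +
          (ε⁻¹ • (F (xo s + ε • y s) - F (xo s)) - F' (xo s) (y s)) := by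
      rw [smul_sub, smul_sub, smul_sub]; abel
    have hd : xε ε s - (xo s + ε • y s) = ε • (ε⁻¹ • (xε ε s - xo s) - y s) := by
      rw [smul_sub, smul_inv_smul₀ hε1.1]; abel
    rw [hsplit]
    refine (norm_add_le _ _).trans (add_le_add_left ?_ _)
    rw [hd, norm_smul, Real.norm_eq_abs] at hlip
    rw [norm_smul, norm_inv, Real.norm_eq_abs]
    calc |ε|⁻¹ * _ ≤ |ε|⁻¹ * (L * (|ε| * ‖ε⁻¹ • (xε ε s - xo s) - y s‖)) := by gcongr
      _ = _ := by field_simp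

end Linearization

/-! ### Admissible horizons and the derivative of the control-to-state map -/

section ControlToStateMap

theorem integrable_control {U : Type*} [NormedAddCommGroup U] {p : ℝ≥0∞} [Fact (1 ≤ p)] {τ : ℝ}
    (u : Lp U p (timeMeasure τ)) : Integrable u (timeMeasure τ) :=
  (Lp.memLp u).integrable Fact.out

/-- Hölder's inequality; for `p > 1` the exponent of `τ` is positive, so controls of bounded norm
contribute little on short horizons. -/
theorem integral_norm_control_le {U : Type*} [NormedAddCommGroup U] {p : ℝ≥0∞} [Fact (1 ≤ p)]
    {τ : ℝ} (hτ : 0 < τ) (u : Lp U p (timeMeasure τ)) :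
    ∫ s in (0 : ℝ)..τ, ‖u s‖ ≤ τ ^ (1 - 1 / p.toReal) * ‖u‖ := by
  rw [intervalIntegral.integral_of_le hτ.le, integral_norm_eq_lintegral_enorm
    (integrable_control u).1, ← eLpNorm_one_eq_lintegral_enorm, Lp.norm_def, mul_comm]
  have h := eLpNorm_le_eLpNorm_mul_rpow_measure_univ (Fact.out : 1 ≤ p) (integrable_control u).1
  have hμ : timeMeasure τ univ = ENNReal.ofReal τ := by simp
  rw [hμ, ENNReal.ofReal_rpow_of_pos hτ] at h
  have h2 := ENNReal.toReal_mono (ENNReal.mul_ne_top (Lp.eLpNorm_ne_top u) ENNReal.ofReal_ne_top) h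
  rw [ENNReal.toReal_mul, ENNReal.toReal_ofReal (by positivity)] at h2
  simpa using h2

variable {X U : Type*} [NormedAddCommGroup X] [NormedSpace ℝ X] [NormedAddCommGroup U]
  [NormedSpace ℝ U]

theorem exists_admissibleHorizon [CompleteSpace X] {K : Type*} {T : ℝ → X →L[ℝ] X}
    (hT : IsStronglyContinuousSemigroup T) {F : X → X} (hF0 : F 0 = 0)
    (hF : ∀ δ : ℝ, 0 < δ → ∃ L : ℝ, 0 < L ∧ ∀ x₁ x₂ : X, ‖x₁‖ ≤ δ → ‖x₂‖ ≤ δ →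
      ‖F x₂ - F x₁‖ ≤ L * ‖x₂ - x₁‖)
    {B : K → U →L[ℝ] X} (hB : ∃ M : ℝ, 0 < M ∧ ∀ r : K, ‖B r‖ ≤ M)
    {p : ℝ≥0∞} [Fact (1 ≤ p)] (hp : 1 < p) (hp' : p ≠ ∞) (R : ℝ) (x₀ : X) :
    ∃ τ : ℝ, 0 < τ ∧ IsAdmissibleHorizon T F B p R x₀ τ := by
  obtain ⟨M, hM0, hM⟩ := hT.exists_norm_le zero_le_one
  obtain ⟨N, hN0, hN⟩ := hB
  -- The free motion uses `M‖x₀‖` of the radius; the spare `1` absorbs the nonlinear and control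
  -- terms, which vanish as `τ → 0`. Since `M` bounds the semigroup on `[0,1]`, `τ < 1` is also
  -- imposed.
  set δ := M * ‖x₀‖ + 1 with hδ
  obtain ⟨L, hL0, hL⟩ := hF δ (by positivity)
  have he : 0 < 1 - 1 / p.toReal := by
    have : 1 < p.toReal := by simpa using ENNReal.toReal_strict_mono hp' hp
    rw [sub_pos, div_lt_one (by linarith)]
    exact this
  have hpow := Real.continuous_rpow_const he.le
  have h1 : Tendsto (fun τ : ℝ => M * (L * δ) * τ + M * (N * (τ ^ (1 - 1 / p.toReal) * R)))
      (𝓝[>] 0) (𝓝 0) := by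
    have : Continuous fun τ : ℝ => M * (L * δ) * τ + M * (N * (τ ^ (1 - 1 / p.toReal) * R)) := by
      fun_prop
    have h := (this.tendsto 0).mono_left (nhdsWithin_le_nhds (s := Ioi 0))
    simpa only [mul_zero, Real.zero_rpow he.ne', zero_mul, add_zero] using h
  have h2 : Tendsto (fun τ : ℝ => M * L * τ) (𝓝[>] 0) (𝓝 0) := by
    have : Continuous fun τ : ℝ => M * L * τ := by fun_prop
    simpa using (this.tendsto 0).mono_left (nhdsWithin_le_nhds (s := Ioi 0))
  obtain ⟨τ, ⟨⟨hτ1, hτ2⟩, hτ0, hτ3⟩⟩ := ((h1.eventually_lt_const one_pos).and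
    (h2.eventually_lt_const (by norm_num : (0 : ℝ) < 1 / 2)) |>.and
      (Ioo_mem_nhdsGT (zero_lt_one' ℝ))).exists
  refine ⟨τ, hτ0, fun r u hu => ?_⟩
  have hui : IntervalIntegrable u volume 0 τ :=
    (intervalIntegrable_iff_integrableOn_Ioc_of_le hτ0.le).2 (integrable_control u)
  refine exists_mildSolution_of_small hT (continuous_of_lipschitz_on_balls hF) hF0 hτ0.le
    (by positivity) hL0.le hL hM0 (fun t ht => hM t ⟨ht.1, ht.2.trans hτ3.le⟩)
    ((B r).integrable_comp (integrable_control u)) ?_ hτ2.le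
  have hBu : ∫ s in (0 : ℝ)..τ, ‖B r (u s)‖ ≤ N * (τ ^ (1 - 1 / p.toReal) * R) :=
    calc _ ≤ ∫ s in (0 : ℝ)..τ, N * ‖u s‖ :=
          intervalIntegral.integral_mono_on hτ0.le
            ((intervalIntegrable_iff_integrableOn_Ioc_of_le hτ0.le).2
              ((B r).integrable_comp (integrable_control u))).norm (hui.norm.const_mul N)
            fun s _ => (B r).le_of_opNorm_le (hN r) _
      _ = N * ∫ s in (0 : ℝ)..τ, ‖u s‖ := intervalIntegral.integral_const_mul _ _
      _ ≤ _ := by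
          refine mul_le_mul_of_nonneg_left ((integral_norm_control_le hτ0 u).trans ?_) hN0.le
          exact mul_le_mul_of_nonneg_left hu (by positivity)
  have := mul_le_mul_of_nonneg_left hBu hM0
  linarith

theorem isControlledSolution_statePath {p : ℝ≥0∞} {T : ℝ → X →L[ℝ] X} {F : X → X}
    {B : U →L[ℝ] X} {x₀ : X} {τ : ℝ} {u : Lp U p (timeMeasure τ)}
    (h : ∃ x : ℝ → X, IsControlledSolution T F B x₀ τ u x) :
    IsControlledSolution T F B x₀ τ u (statePath T F B x₀ τ u) := by
  rw [statePath, dif_pos h]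
  exact h.choose_spec

theorem IsControlledSolution.eqOn [CompleteSpace X] {p : ℝ≥0∞} {T : ℝ → X →L[ℝ] X}
    (hT : IsStronglyContinuousSemigroup T) {F : X → X}
    (hF : ∀ δ : ℝ, 0 < δ → ∃ L : ℝ, 0 < L ∧ ∀ x₁ x₂ : X, ‖x₁‖ ≤ δ → ‖x₂‖ ≤ δ →
      ‖F x₂ - F x₁‖ ≤ L * ‖x₂ - x₁‖)
    {B : U →L[ℝ] X} {x₀ : X} {τ : ℝ} (hτ : 0 ≤ τ) {u : Lp U p (timeMeasure τ)} {x x' : ℝ → X}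
    (h : IsControlledSolution T F B x₀ τ u x) (h' : IsControlledSolution T F B x₀ τ u x') :
    EqOn x x' (Icc 0 τ) := by
  obtain ⟨M, hM0, hM⟩ := hT.exists_norm_le hτ
  obtain ⟨r, hr⟩ := isCompact_Icc.exists_bound_of_continuousOn h.continuousOn
  obtain ⟨r', hr'⟩ := isCompact_Icc.exists_bound_of_continuousOn h'.continuousOn
  obtain ⟨L, hL0, hL⟩ := hF (max 1 (max r r')) (by positivity)
  refine IsMildSolution.eqOn h h' hM0 hM hL0.le fun s hs => hL _ _ ?_ ?_
  · exact (hr' s hs).trans ((le_max_right _ _).trans (le_max_right _ _))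
  · exact (hr s hs).trans ((le_max_left _ _).trans (le_max_right _ _))

theorem exists_clm_variation_of_constants {V : ℝ → ℝ → X →L[ℝ] X} {D : ℝ} (hD0 : 0 ≤ D)
    (hD : ∀ t s, ‖V t s‖ ≤ D) (hV : Continuous fun q : (ℝ × ℝ) × X => V q.1.1 q.1.2 q.2)
    (B : U →L[ℝ] X) (p : ℝ≥0∞) [Fact (1 ≤ p)] {τ : ℝ} (hτ : 0 < τ) :
    ∃ S' : Lp U p (timeMeasure τ) →L[ℝ] Lp X p (timeMeasure τ),
      ∀ v : Lp U p (timeMeasure τ), S' v =ᵐ[timeMeasure τ] fun t => ∫ s in (0 : ℝ)..t, V t s (B (v s)) := by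
  have hBi : ∀ v : Lp U p (timeMeasure τ), Integrable (fun s => B (v s)) (timeMeasure τ) :=
    fun v => B.integrable_comp (integrable_control v)
  set y : Lp U p (timeMeasure τ) → ℝ → X := fun v t => ∫ s in (0 : ℝ)..t, V t s (B (v s)) with hy
  have hyL : ∀ v, MemLp (y v) p (timeMeasure τ) := fun v =>
    memLp_of_continuousOn (continuousOn_integral_family hD hV (hBi v)) p
  have hint : ∀ v : Lp U p (timeMeasure τ), ∀ t ∈ Ioc 0 τ,
      IntervalIntegrable (fun s => V t s (B (v s))) volume 0 t :=
    fun v t ht => intervalIntegrable_family hD hV (hBi v) t ⟨ht.1.le, ht.2⟩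
  -- The integral depends only on the almost-everywhere class of the control, which makes it linear
  -- on `Lᵖ`.
  have hcongr : ∀ {v : Lp U p (timeMeasure τ)} {w : ℝ → U}, v =ᵐ[timeMeasure τ] w →
      ∀ t ∈ Ioc 0 τ, y v t = ∫ s in (0 : ℝ)..t, V t s (B (w s)) := fun {v w} hvw t ht => by
    refine intervalIntegral.integral_congr_ae
      (((ae_restrict_iff' measurableSet_Ioc).1 hvw).mono fun s hs hst => ?_)
    rw [uIoc_of_le ht.1.le] at hst
    rw [hs ⟨hst.1, hst.2.trans ht.2⟩]
  have hbound : ∀ v, ∀ t ∈ Ioc 0 τ,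
      ‖y v t‖ ≤ D * ‖B‖ * (τ ^ (1 - 1 / p.toReal) * ‖v‖) := fun v t ht => by
    have hvi : IntervalIntegrable v volume 0 τ :=
      (intervalIntegrable_iff_integrableOn_Ioc_of_le hτ.le).2 (integrable_control v)
    calc _ ≤ ∫ s in (0 : ℝ)..t, D * ‖B‖ * ‖v s‖ :=
          intervalIntegral.norm_integral_le_of_norm_le ht.1.le
            (ae_of_all _ fun s _ => by
              rw [mul_assoc]
              exact (V t s).le_of_opNorm_le_of_le (hD t s) (B.le_opNorm _))
            ((hvi.norm.const_mul _).mono_set (by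
              rw [uIcc_of_le ht.1.le, uIcc_of_le hτ.le]; exact Icc_subset_Icc_right ht.2))
      _ ≤ ∫ s in (0 : ℝ)..τ, D * ‖B‖ * ‖v s‖ :=
          intervalIntegral.integral_mono_interval le_rfl ht.1.le ht.2
            (ae_of_all _ fun s => by positivity) (hvi.norm.const_mul _)
      _ = D * ‖B‖ * ∫ s in (0 : ℝ)..τ, ‖v s‖ := intervalIntegral.integral_const_mul _ _
      _ ≤ _ := mul_le_mul_of_nonneg_left (integral_norm_control_le hτ v) (by positivity)
  let S₀ : Lp U p (timeMeasure τ) →ₗ[ℝ] Lp X p (timeMeasure τ) :=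
    { toFun := fun v => (hyL v).toLp (y v)
      map_add' := fun v w => by
        rw [← MemLp.toLp_add]
        refine MemLp.toLp_congr _ _ ((ae_restrict_iff' measurableSet_Ioc).2
          (ae_of_all _ fun t ht => ?_))
        rw [hcongr (Lp.coeFn_add v w) t ht, Pi.add_apply, hy]
        simp only [Pi.add_apply, map_add]
        exact intervalIntegral.integral_add (hint v t ht) (hint w t ht)
      map_smul' := fun a v => by
        rw [RingHom.id_apply, ← MemLp.toLp_const_smul]
        refine MemLp.toLp_congr _ _ ((ae_restrict_iff' measurableSet_Ioc).2
          (ae_of_all _ fun t ht => ?_))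
        rw [hcongr (Lp.coeFn_smul a v) t ht, Pi.smul_apply, hy]
        simp only [Pi.smul_apply, map_smul]
        exact intervalIntegral.integral_smul _ _ }
  refine ⟨S₀.mkContinuous ((measureUnivNNReal (timeMeasure τ) : ℝ) ^ (p.toReal)⁻¹ *
    (D * ‖B‖ * τ ^ (1 - 1 / p.toReal))) fun v => ?_, fun v => (hyL v).coeFn_toLp⟩
  refine (Lp.norm_le_of_ae_bound (C := D * ‖B‖ * (τ ^ (1 - 1 / p.toReal) * ‖v‖))
    (by positivity) ?_).trans (le_of_eq (by ring))
  filter_upwards [(hyL v).coeFn_toLp, ae_restrict_mem measurableSet_Ioc] with t ht htI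
  change ‖(hyL v).toLp (y v) t‖ ≤ _
  rw [ht]
  exact hbound v t htI

/-- On a finite measure space uniform convergence on `[0,τ]` implies `Lᵖ` convergence, so the
trajectory estimate transfers to the classes in `Lᵖ`. -/
theorem hasGateauxDerivAt_controlToState [CompleteSpace X] {T : ℝ → X →L[ℝ] X}
    (hT : IsStronglyContinuousSemigroup T) {F : X → X}
    (hF : ∀ δ : ℝ, 0 < δ → ∃ L : ℝ, 0 < L ∧ ∀ x₁ x₂ : X, ‖x₁‖ ≤ δ → ‖x₂‖ ≤ δ →
      ‖F x₂ - F x₁‖ ≤ L * ‖x₂ - x₁‖)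
    {F' : X → X →L[ℝ] X} (hF' : ∀ x : X, HasGateauxDerivAt F (F' x) x)
    (hF'bdd : ∀ s : Set X, Bornology.IsBounded s → Bornology.IsBounded (F' '' s))
    {B : U →L[ℝ] X} {p : ℝ≥0∞} [Fact (1 ≤ p)] {x₀ : X} {τ : ℝ} (hτ : 0 < τ)
    {uo : Lp U p (timeMeasure τ)}
    (hsol : ∀ᶠ u in 𝓝 uo, ∃ x : ℝ → X, IsControlledSolution T F B x₀ τ u x)
    {S' : Lp U p (timeMeasure τ) →L[ℝ] Lp X p (timeMeasure τ)}
    (hS' : ∀ v, ∃ y : ℝ → X, IsMildSolution T (fun t z => F' (statePath T F B x₀ τ uo t) z)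
      (fun t => B (v t)) 0 τ y ∧ S' v =ᵐ[timeMeasure τ] y) :
    HasGateauxDerivAt (controlToState T F B x₀ τ) S' uo := by
  intro v
  obtain ⟨y, hy, hSy⟩ := hS' v
  rw [HasLineDerivAt, hasDerivAt_iff_tendsto_slope_zero, Metric.tendsto_nhds]
  intro η hη
  set c : ℝ := (measureUnivNNReal (timeMeasure τ) : ℝ) ^ (p.toReal)⁻¹ with hc
  have hc0 : 0 ≤ c := by positivity
  have hnhds : ∀ᶠ ε : ℝ in 𝓝[≠] 0, ∃ x : ℝ → X,
      IsControlledSolution T F B x₀ τ (uo + ε • v) x := by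
    have hlim : Tendsto (fun ε : ℝ => uo + ε • v) (𝓝[≠] 0) (𝓝 uo) := by
      have : Continuous fun ε : ℝ => uo + ε • v := by fun_prop
      simpa using (this.tendsto 0).mono_left nhdsWithin_le_nhds
    exact hlim.eventually hsol
  have key := eventually_norm_slope_sub_le hT hF hF' hF'bdd hτ.le
    (f := fun s => B (uo s)) (g := fun s => B (v s)) (xo := statePath T F B x₀ τ uo) (y := y)
    (fε := fun ε s => B ((uo + ε • v : Lp U p (timeMeasure τ)) s))
    -- The `Lᵖ` norm is at most `c` times a uniform bound, and `c * η / (2(c + 1)) < η`.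
    (xε := fun ε => statePath T F B x₀ τ (uo + ε • v)) (η := η / (2 * (c + 1)))
    (B.integrable_comp (integrable_control v))
    (isControlledSolution_statePath hsol.self_of_nhds) hy
    (hnhds.mono fun ε hε => isControlledSolution_statePath hε)
    (fun ε => by
      filter_upwards [Lp.coeFn_add uo (ε • v), Lp.coeFn_smul ε v] with s h1 h2
      rw [h1, Pi.add_apply, h2, Pi.smul_apply, map_add, map_smul]) (by positivity)
  filter_upwards [key] with ε hε
  rw [dist_eq_norm, zero_add, zero_smul, add_zero]
  refine lt_of_le_of_lt (Lp.norm_le_of_ae_bound (C := η / (2 * (c + 1))) (by positivity) ?_) ?_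
  · set z : ℝ → Lp X p (timeMeasure τ) := fun ε => controlToState T F B x₀ τ (uo + ε • v)
    set zo : Lp X p (timeMeasure τ) := controlToState T F B x₀ τ uo
    filter_upwards [hSy, (memLp_statePath T F B x₀ τ (uo + ε • v)).coeFn_toLp,
      (memLp_statePath T F B x₀ τ uo).coeFn_toLp, Lp.coeFn_sub (ε⁻¹ • (z ε - zo)) (S' v),
      Lp.coeFn_smul ε⁻¹ (z ε - zo), Lp.coeFn_sub (z ε) zo,
      ae_restrict_mem measurableSet_Ioc] with t h1 h2 h3 h4 h5 h6 ht
    rw [h4, Pi.sub_apply, h5, Pi.smul_apply, h6, Pi.sub_apply, h1]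
    change ‖ε⁻¹ • ((memLp_statePath T F B x₀ τ (uo + ε • v)).toLp _ t -
      (memLp_statePath T F B x₀ τ uo).toLp _ t) - y t‖ ≤ _
    rw [h2, h3]
    exact hε t (Ioc_subset_Icc_self ht)
  · rw [← hc, ← mul_div_assoc, div_lt_iff₀ (by positivity)]
    nlinarith

end ControlToStateMap

end ControlToState

/-! ### The main theorem -/

open ControlToState in
theorem mainTheorem5
    {X U 𝕂 : Type*}
    [NormedAddCommGroup X] [NormedSpace ℝ X] [CompleteSpace X]
    [TopologicalSpace.SeparableSpace X]
    [NormedAddCommGroup U] [NormedSpace ℝ U] [CompleteSpace U]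
    [TopologicalSpace 𝕂]
    (hX : IsReflexive X) (hU : IsReflexive U)
    -- the linear part generates a strongly continuous semigroup
    (A : X →ₗ.[ℝ] X) (T : ℝ → X →L[ℝ] X)
    (hT : IsStronglyContinuousSemigroup T) (hA : IsGenerator A T)
    -- the nonlinearity is locally Lipschitz
    (F : X → X) (hF0 : F 0 = 0)
    (hF : ∀ δ : ℝ, 0 < δ → ∃ L : ℝ, 0 < L ∧ ∀ x₁ x₂ : X, ‖x₁‖ ≤ δ → ‖x₂‖ ≤ δ →
      ‖F x₂ - F x₁‖ ≤ L * ‖x₂ - x₁‖)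
    -- the input operators are uniformly bounded
    (K : Set 𝕂) (B : K → U →L[ℝ] X)
    (hB : ∃ M : ℝ, 0 < M ∧ ∀ r : K, ‖B r‖ ≤ M)
    -- the nonlinearity is Gâteaux differentiable with bounded derivative
    (F' : X → X →L[ℝ] X) (hF' : ∀ x : X, HasGateauxDerivAt F (F' x) x)
    (hF'bdd : ∀ s : Set X, Bornology.IsBounded s → Bornology.IsBounded (F' '' s))
    (p : ℝ≥0∞) [Fact (1 ≤ p)] (hp : 1 < p) (hp' : p ≠ ∞)
    (R : ℝ) (hR : 0 < R) (x₀ : X) :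
    -- there are horizons on which the control-to-state map is defined
    (∃ τ : ℝ, 0 < τ ∧ IsAdmissibleHorizon T F B p R x₀ τ) ∧
    ∀ τ : ℝ, 0 < τ → IsAdmissibleHorizon T F B p R x₀ τ → ∀ r : K,
      -- the state is uniquely determined by the control
      (∀ u ∈ admissibleControls U p R τ, ∀ x : ℝ → X, IsControlledSolution T F (B r) x₀ τ u x →
        EqOn x (statePath T F (B r) x₀ τ u) (Icc 0 τ)) ∧
      ∀ uo ∈ interior (admissibleControls U p R τ),
        ∃ S' : Lp U p (timeMeasure τ) →L[ℝ] Lp X p (timeMeasure τ),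
          HasGateauxDerivAt (controlToState T F (B r) x₀ τ) S' uo ∧
          ∃ V : ℝ → ℝ → X →L[ℝ] X,
            IsEvolutionOperator T (fun t => F' (statePath T F (B r) x₀ τ uo t)) τ V ∧
            ∀ v : Lp U p (timeMeasure τ), ∃ y : ℝ → X,
              -- `y` is the unique mild solution of the linearized equation with input `v`
              IsMildSolution T (fun t z => F' (statePath T F (B r) x₀ τ uo t) z)
                (fun t => B r (v t)) 0 τ y ∧
              (∀ z : ℝ → X, IsMildSolution T (fun t z => F' (statePath T F (B r) x₀ τ uo t) z)
                (fun t => B r (v t)) 0 τ z → EqOn z y (Icc 0 τ)) ∧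
              -- it is the derivative in the direction `v`
              S' v =ᵐ[timeMeasure τ] y ∧
              -- and it is represented by the evolution operator
              ∀ t ∈ Icc 0 τ,
                IntervalIntegrable (fun s => V t s (B r (v s))) volume 0 t ∧
                y t = ∫ s in (0 : ℝ)..t, V t s (B r (v s)) := by
  refine ⟨exists_admissibleHorizon hT hF0 hF hB hp hp' R x₀, fun τ hτ hadm r =>
    ⟨fun u hu x hx => hx.eqOn hT hF hτ.le (isControlledSolution_statePath (hadm r u hu)),
      fun uo huo => ?_⟩⟩
  -- At an interior control every nearby control is admissible, so `uo + εv` has a state for small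
  -- `ε` in every direction `v`.
  have hsol : ∀ᶠ u in 𝓝 uo, ∃ x : ℝ → X, IsControlledSolution T F (B r) x₀ τ u x :=
    Filter.mem_of_superset (mem_interior_iff_mem_nhds.1 huo) fun u hu => hadm r u hu
  set xo := statePath T F (B r) x₀ τ uo with hxo
  have hxoc : ContinuousOn xo (Icc 0 τ) :=
    (isControlledSolution_statePath hsol.self_of_nhds).continuousOn
  -- The extension stays in the ball containing `xo`, so `F'(zo t)` is bounded for all real `t`; it
  -- agrees with `F'(xo t)` on `[0,τ]`, and the results are carried back by congruence.
  set zo : ℝ → X := IccExtend hτ.le ((Icc 0 τ).domRestrict xo) with hzo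
  have hzoc : Continuous zo := continuous_IccExtend_iff.2 hxoc.domRestrict
  have hzoeq : ∀ s ∈ Icc 0 τ, zo s = xo s := fun s hs => IccExtend_of_mem hτ.le _ hs
  obtain ⟨ρ, hρ⟩ := isCompact_Icc.exists_bound_of_continuousOn hxoc
  obtain ⟨C, hC0, hC⟩ :=
    (hF'bdd _ (Metric.isBounded_closedBall (x := (0 : X)) (r := ρ))).exists_pos_norm_le
  have hGC : ∀ t, ‖F' (zo t)‖ ≤ C := fun t =>
    hC _ ⟨_, mem_closedBall_zero_iff.2 (hρ _ (projIcc 0 τ hτ.le t).2), rfl⟩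
  have hG : IsLimitOfContinuous fun s => F' (zo s) :=
    isLimitOfContinuous_gateaux (continuous_of_lipschitz_on_balls hF) hF' hzoc
  have hGeq : ∀ s ∈ Icc 0 τ, F' (zo s) = F' (xo s) := fun s hs => by rw [hzoeq s hs]
  obtain ⟨V, D, hD0, hD, hV, hVop⟩ := exists_evolutionOperator hT hC0.le hGC hG hτ.le
  obtain ⟨S', hS'⟩ := exists_clm_variation_of_constants hD0 hD hV (B r) p hτ
  obtain ⟨M, hM0, hM⟩ := hT.exists_norm_le hτ.le
  have hBi : ∀ v : Lp U p (timeMeasure τ), Integrable (fun s => B r (v s)) (timeMeasure τ) :=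
    fun v => (B r).integrable_comp (integrable_control v)
  have hy : ∀ v : Lp U p (timeMeasure τ), IsMildSolution T (fun t z => F' (xo t) z)
      (fun t => B r (v t)) 0 τ (fun t => ∫ s in (0 : ℝ)..t, V t s (B r (v s))) := fun v =>
    (hVop.isMildSolution hT hGC hG hτ.le hD hV (hBi v)).congr_perturbation
      fun s hs z => by rw [hGeq s hs]
  refine ⟨S', hasGateauxDerivAt_controlToState hT hF hF' hF'bdd hτ hsol
    fun v => ⟨_, hy v, hS' v⟩, V, hVop.congr hGeq, fun v => ⟨_, hy v, fun z hz => ?_, hS' v,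
      fun t ht => ⟨intervalIntegrable_family hD hV (hBi v) t ht, rfl⟩⟩⟩
  refine hz.eqOn (hy v) hM0 hM hC0.le fun s hs => ?_
  rw [← map_sub, ← hGeq s hs]
  exact (F' (zo s)).le_of_opNorm_le (hGC s) _
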